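/- **Setting.** Let $p\ge 1$. A plant is given by a steady-state map $y=h(u,d)$, $h:\mathbb R^p\times\mathbb R^r\to\mathbb R^q$, differentiable in $u$. Given disturbances $d_k\in\mathbb R^r$, differentiable objectives $\Phi_k:\mathbb R^p\times\mathbb R^q\to\mathbb R$ ($k\in\mathbb N$) and a nonempty closed convex bounded set $\mathcal U\subset\mathbb R^p$, put $\tilde\Phi_k(u)=\Phi_k(u,h(u,d_k))$ and let $u_k^*$ be a solution of $\min\{\Phi_k(u,y): y=h(u,d_k),\ u\in\mathcal U\}$. For some $\tau>0$ let $\mathcal U_\tau=\{u+\tau v: u\in\mathcal U,\ \|v\|\le 1\}$. Assume that on $\mathcal U_\tau$ each $\tilde\Phi_k$ is $\mu_k$-strongly convex ($\mu_k>0$), $L_k$-smooth (its gradient is $L_k$-Lipschitz), $M_k$-Lipschitz, and bounded by $|\tilde\Phi_k|\le G$ with $G$ independent of $k$; that $y\mapsto\Phi_k(u,y)$ is $M_{\Phi,k}$-Lipschitz for each $u\in\mathcal U_\tau$; and that the sequences $\{L_k\},\{M_k\},\{M_{\Phi,k}\}$ are bounded. The running gray-box controller, with step size $\eta$, smoothing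 parameter $\delta$, coefficients $\alpha_k\in[0,1]$ and deterministic initial point $w_0\in\mathcal U$, in closed loop with the plant, is, for $k\in\mathbb N$, $$u_k=w_k+\delta v_k,\qquad y_k=h(u_k,d_k),\qquad w_{k+1}=\mathrm{Proj}_{\mathcal U}(w_k-\eta\hat\phi_k),$$ $$\hat\phi_k=\alpha_k\big(\nabla_u\Phi_k(u_k,y_k)+\hat H_k^\top\nabla_y\Phi_k(u_k,y_k)\big)+(1-\alpha_k)\frac{p\,v_k}{\delta}\big(\Phi_k(u_k,y_k)-\Phi_{k-1}(u_{k-1},y_{k-1})\big),$$ where for $k=0$ the value $\Phi_{-1}(u_{-1},y_{-1})$ is a given number of absolute value at most $G$. Here $v_0,v_1,\dots$ are i.i.d. uniform on the unit sphere of $\mathbb R^p$, adapted to a filtration $(\mathcal F_k)$ such that $v_{k+1}$ is independent of $\mathcal F_k$, and the approximate sensitivities $\hat H_k\in\mathbb R^{q\times p}$ (possibly random) are $\mathcal F_k$-measurable. Let $\epsilon_{H,k}=\|\hat H_k-\nabla_u h(u_k,d_k)\|$ (spectral norm). Fix $T\ge 1$ and assume $\mathbb E[\epsilon_{H,k}]<\infty$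 for every $k<T$ with $\alpha_k>0$. Set $$\gamma_k=\alpha_kM_{\Phi,k}\,\mathbb E[\epsilon_{H,k}]+(1-\alpha_k)\frac{2pG}{\delta}+L_k\delta\Big(\alpha_k+(1-\alpha_k)\frac p2\Big)$$ (the first term being $0$ if $\alpha_k=0$), $$\rho=\max_{0\le k\le T-1}\max\{|1-\eta\mu_k|,|1-\eta L_k|\},\qquad \sigma_{u^*}=\max_{1\le k\le T}\|u_k^*-u_{k-1}^*\|.$$ **Theorem 5.** Let $\eta\in(0,2/\sup_{k\in\mathbb N}L_k)$ and $\delta\in(0,\tau)$. Then $0\le\rho<1$, with $\rho>0$ unless $\eta\mu_k=\eta L_k=1$ for all $k<T$; for every $k<T$, $\mathbb E\|\hat\phi_k-\nabla\tilde\Phi_k(w_k)\|\le\gamma_k$; and $$\mathbb E\|w_T-u_T^*\|\le\rho^T\|w_0-u_0^*\|+\eta\sum_{k=0}^{T-1}\rho^{T-1-k}\gamma_k+\frac{\sigma_{u^*}}{1-\rho},$$ where both expectations are finite. -/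

import Mathlib

open MeasureTheory ProbabilityTheory

noncomputable section

/-- `ℝⁿ` with its Euclidean norm. -/
abbrev Vec (n : ℕ) : Type := EuclideanSpace ℝ (Fin n)

/-- The uniform distribution on the unit sphere of `ℝᵖ`, as a measure on `ℝᵖ`: the normalized
surface measure (for `p = 1` it gives mass `1/2` to each of `1` and `-1`). -/
def uniformSphere (p : ℕ) : Measure (Vec p) :=
  (((volume : Measure (Vec p)).toSphere Set.univ)⁻¹ • (volume : Measure (Vec p)).toSphere).map
    Subtype.val

/-- The Euclidean projection of `x` onto `U`: a point of `U` nearest to `x`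
(it exists and is unique when `U` is closed, convex and nonempty). -/
def proj {p : ℕ} (U : Set (Vec p)) (x : Vec p) : Vec p :=
  Classical.epsilon fun z => z ∈ U ∧ ∀ z' ∈ U, ‖x - z‖ ≤ ‖x - z'‖

/-- `f` is `L`-smooth on `s`: differentiable at the points of `s`, with `L`-Lipschitz gradient
on `s`. -/
def IsSmoothOn {p : ℕ} (f : Vec p → ℝ) (s : Set (Vec p)) (L : ℝ) : Prop :=
  (∀ x ∈ s, DifferentiableAt ℝ f x) ∧
    ∀ x ∈ s, ∀ x' ∈ s, ‖gradient f x - gradient f x'‖ ≤ L * ‖x - x'‖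

/-- The data of the time-varying problem `min Φ_k(u, y)` subject to `y = h(u, d_k)`, `u ∈ U`. -/
structure TVProblem (p q r : ℕ) where
  /-- steady-state input-output map of the plant -/
  h : Vec p → Vec r → Vec q
  /-- disturbances -/
  d : ℕ → Vec r
  /-- objectives -/
  Φ : ℕ → Vec p → Vec q → ℝ
  /-- constraint set for the input -/
  U : Set (Vec p)

namespace TVProblem

variable {p q r : ℕ}

/-- The reduced objective `u ↦ Φ_k(u, h(u, d_k))` at time `k`. -/
def obj (S : TVProblem p q r) (k : ℕ) (u : Vec p) : ℝ := S.Φ k u (S.h u (S.d k))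

/-- The inflated constraint set `U_τ = {u + τ v | u ∈ U, ‖v‖ ≤ 1}`. -/
def inflated (S : TVProblem p q r) (τ : ℝ) : Set (Vec p) :=
  {x | ∃ u ∈ S.U, ∃ v : Vec p, ‖v‖ ≤ 1 ∧ x = u + τ • v}

/-- The true sensitivity `∇_u h(u, d_k)` of the plant at time `k` (a `q × p` matrix, seen as a
linear map; its norm is the spectral norm). -/
def sensitivity (S : TVProblem p q r) (k : ℕ) (u : Vec p) : Vec p →L[ℝ] Vec q :=
  fderiv ℝ (fun u' => S.h u' (S.d k)) u

/-- `u` solves the problem at time `k`. -/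
def IsOptimal (S : TVProblem p q r) (k : ℕ) (u : Vec p) : Prop :=
  u ∈ S.U ∧ ∀ u' ∈ S.U, S.Φ k u (S.h u (S.d k)) ≤ S.Φ k u' (S.h u' (S.d k))

/-- Standing assumptions on the problem. The conditions on the objective as a function of `u` are
required on the inflated set `U_τ`, which contains all candidate solutions and all inputs (no
strongly convex function is Lipschitz on the whole of `ℝᵖ`). -/
structure Assumptions (S : TVProblem p q r) (μ L M MΦ : ℕ → ℝ) (G τ : ℝ) : Prop where
  /-- the steady-state map is differentiable with respect to `u` -/
  h_diff : ∀ d, Differentiable ℝ fun u => S.h u d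
  /-- the objectives are differentiable -/
  Φ_diff : ∀ k, Differentiable ℝ fun x : Vec p × Vec q => S.Φ k x.1 x.2
  U_closed : IsClosed S.U
  U_convex : Convex ℝ S.U
  U_bounded : ∃ D > 0, ∀ u₁ ∈ S.U, ∀ u₂ ∈ S.U, ‖u₁ - u₂‖ ≤ D
  τ_pos : 0 < τ
  /-- the reduced objectives are uniformly bounded on `U_τ` -/
  obj_bounded : ∀ u ∈ S.inflated τ, ∀ k, |S.obj k u| ≤ G
  μ_pos : ∀ k, 0 < μ k
  obj_strongConvex : ∀ k, StrongConvexOn (S.inflated τ) (μ k) (S.obj k)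
  obj_smooth : ∀ k, IsSmoothOn (S.obj k) (S.inflated τ) (L k)
  obj_lipschitz : ∀ k, ∀ u ∈ S.inflated τ, ∀ u' ∈ S.inflated τ,
    |S.obj k u - S.obj k u'| ≤ M k * ‖u - u'‖
  Φ_lipschitz : ∀ k, ∀ u ∈ S.inflated τ, ∀ y y' : Vec q,
    |S.Φ k u y - S.Φ k u y'| ≤ MΦ k * ‖y - y'‖
  L_bdd : BddAbove (Set.range L)
  M_bdd : BddAbove (Set.range M)
  MΦ_bdd : BddAbove (Set.range MΦ)

/-- The model-based direction `∇_u Φ_k(u, y) + Ĥᵀ ∇_y Φ_k(u, y)`. -/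
def modelBasedDir (S : TVProblem p q r) (k : ℕ) (Hhat : Vec p →L[ℝ] Vec q) (u : Vec p)
    (y : Vec q) : Vec p :=
  gradient (fun u' => S.Φ k u' y) u +
    ContinuousLinearMap.adjoint Hhat (gradient (fun y' => S.Φ k u y') y)

/-- The objective value measured one step before time `k`: `Φ_{k-1}(u_{k-1}, y_{k-1})` for `k ≥ 1`,
and the initial value `z₀` for `k = 0`. -/
def prevValue (S : TVProblem p q r) (z₀ : ℝ) (u : ℕ → Vec p) (y : ℕ → Vec q) : ℕ → ℝ
  | 0 => z₀
  | k + 1 => S.Φ k (u k) (y k)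

/-- The model-free direction `(p v_k / δ) (Φ_k(u_k, y_k) - Φ_{k-1}(u_{k-1}, y_{k-1}))`. -/
def modelFreeDir (S : TVProblem p q r) (δ z₀ : ℝ) (v : ℕ → Vec p) (u : ℕ → Vec p)
    (y : ℕ → Vec q) (k : ℕ) : Vec p :=
  ((p : ℝ) / δ * (S.Φ k (u k) (y k) - S.prevValue z₀ u y k)) • v k

/-- `(w, u, y, φ)` is the trajectory of the closed loop of the plant and the running gray-box
controller driven by the exploration vectors `v` and the approximate sensitivities `Hhat`. -/
structure IsClosedLoop (S : TVProblem p q r) (η δ z₀ : ℝ) (α : ℕ → ℝ) (w₀ : Vec p)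
    (v : ℕ → Vec p) (Hhat : ℕ → Vec p →L[ℝ] Vec q)
    (w u : ℕ → Vec p) (y : ℕ → Vec q) (φ : ℕ → Vec p) : Prop where
  w_zero : w 0 = w₀
  u_eq : ∀ k, u k = w k + δ • v k
  y_eq : ∀ k, y k = S.h (u k) (S.d k)
  φ_eq : ∀ k, φ k = α k • S.modelBasedDir k (Hhat k) (u k) (y k) +
    (1 - α k) • S.modelFreeDir δ z₀ v u y k
  w_succ : ∀ k, w (k + 1) = proj S.U (w k - η • φ k)

end TVProblem

/-- The exploration vectors are drawn from the uniform distribution on the unit sphere, each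
independently of the past: `v k` is known at time `k` and `v (k + 1)` is independent of everything
known at time `k`. In particular they are independent and identically distributed. -/
structure IsExploration {Ω : Type*} {mΩ : MeasurableSpace Ω} {p : ℕ} (P : Measure Ω)
    (ℱ : Filtration ℕ mΩ) (v : ℕ → Ω → Vec p) : Prop where
  adapted : ∀ k, Measurable[ℱ k] (v k)
  law : ∀ k, P.map (v k) = uniformSphere p
  indep : ∀ k, Indep (ℱ k) (MeasurableSpace.comap (v (k + 1)) inferInstance) P

/-- `γ_k = α_k M_Φ ε + (1 - α_k) 2pG/δ + L_k δ (α_k + (1 - α_k) p/2)`, where `ε` stands for the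
(expected) error of the approximate sensitivity. -/
def gammaBound (p : ℕ) (α MΦ L G δ ε : ℝ) : ℝ :=
  α * MΦ * ε + (1 - α) * (2 * p * G / δ) + L * δ * (α + (1 - α) * (p / 2))

end

/-!
The projected gradient step of time `k` has the optimum of time `k` as a fixed point, so the closed
loop is a contraction perturbed by the error of the direction and by the drift of the optimum.

*Contraction.* For a `μ`-strongly convex and `L`-smooth function the map `x ↦ x - η ∇f(x)` is
Lipschitz with constant `max |1 - ημ| |1 - ηL|` (`StrongConvexOn.norm_gradientStep_sub_le`). On the
whole space this follows from cocoercivity of the gradient of `f - μ/2 ‖·‖²`. Here `f` is controlled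
on `U_τ` only, and the proof of cocoercivity leaves the segment between the two points. It does stay
in `U_τ` when the two points of `U` are close, and a map on a convex set that is Lipschitz at small
distances is Lipschitz with the same constant. The projection does not increase distances, which
gives `TVProblem.Assumptions.norm_proj_sub_optimal_le`.

*Error of the direction.* By the chain rule the model-based direction differs from the gradient at
the perturbed input only through the sensitivity error. For the model-free direction, the exploration
vector is independent of the iterate and of the previous objective value, so the latter two can be
frozen. The uniform distribution on the sphere is centered with covariance `I / p`; hence the mean
of the estimator is `∇f(w)` up to the second-order Taylor remainder, which contributes `L δ p / 2`.
The fluctuation around the mean is at most the root mean square of the estimator itself, hence at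
most `2 p G / δ`; the Lipschitz constant of `f` does not enter (`integral_norm_estimator_sub_le`).

Taking expectations gives `e (k + 1) ≤ ρ e k + η γ k + σ` for the mean tracking error `e`, and
unrolling this recursion gives the bound.
-/

/-! ### Gradient inequalities for strongly convex and smooth functions -/

section GradientStep

open Filter Topology
open scoped RealInnerProductSpace

/-- Control of `‖(1 - η m) d - η a‖` under `‖a‖ ^ 2 ≤ l ⟪a, d⟫`, which also forces
`0 ≤ ⟪a, d⟫ ≤ l ‖d‖ ^ 2`. The squared norm is bounded by an affine function of `⟪a, d⟫` on that
interval, and the two values in the maximum come from its end points. -/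
lemma norm_smul_sub_smul_le_max {E : Type*} [NormedAddCommGroup E]
    [InnerProductSpace ℝ E] {a d : E} {η m l : ℝ} (hl : 0 < l)
    (h1 : ‖a‖ ^ 2 ≤ l * ⟪a, d⟫) :
    ‖(1 - η * m) • d - η • a‖ ≤ max |1 - η * m| |1 - η * (m + l)| * ‖d‖ := by
  have h0 : 0 ≤ ⟪a, d⟫ := by
    by_contra! h
    nlinarith [sq_nonneg ‖a‖]
  have hal : ‖a‖ ≤ l * ‖d‖ := by
    by_contra! h
    have := real_inner_le_norm a d
    nlinarith [norm_nonneg a, norm_nonneg d, mul_nonneg hl.le (norm_nonneg d)]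
  have h2 : ⟪a, d⟫ ≤ l * ‖d‖ ^ 2 := by
    have := real_inner_le_norm a d
    nlinarith [norm_nonneg d]
  refine le_of_sq_le_sq ?_ (by positivity)
  rw [mul_pow, norm_sub_sq_real]
  simp only [norm_smul, mul_pow, inner_smul_left, inner_smul_right, Real.norm_eq_abs, sq_abs,
    conj_trivial]
  rw [real_inner_comm a d]
  have m1 : (1 - η * m) ^ 2 ≤ max |1 - η * m| |1 - η * (m + l)| ^ 2 := by
    rw [← sq_abs (1 - η * m)]; gcongr; exact le_max_left _ _
  have m2 : (1 - η * (m + l)) ^ 2 ≤ max |1 - η * m| |1 - η * (m + l)| ^ 2 := by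
    rw [← sq_abs (1 - η * (m + l))]; gcongr; exact le_max_right _ _
  generalize max |1 - η * m| |1 - η * (m + l)| ^ 2 = R at *
  generalize ⟪a, d⟫ = c at *
  have key : (1 - η * m) ^ 2 * (l * ‖d‖ ^ 2 - c) + (1 - η * (m + l)) ^ 2 * c ≤
      R * (l * ‖d‖ ^ 2) := by nlinarith
  have : l * ((1 - η * m) ^ 2 * ‖d‖ ^ 2 - 2 * ((1 - η * m) * (η * c)) + η ^ 2 * ‖a‖ ^ 2) ≤
      l * (R * ‖d‖ ^ 2) := by
    nlinarith [mul_le_mul_of_nonneg_left h1 (mul_nonneg hl.le (sq_nonneg η))]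
  have := le_of_mul_le_mul_left this hl
  linarith

variable {E : Type*} [NormedAddCommGroup E] [InnerProductSpace ℝ E] [CompleteSpace E]

lemma hasDerivAt_comp_add_smul {f : E → ℝ} {x d : E} {t : ℝ}
    (hf : DifferentiableAt ℝ f (x + t • d)) :
    HasDerivAt (fun t : ℝ => f (x + t • d)) ⟪gradient f (x + t • d), d⟫ t := by
  have h1 : HasDerivAt (fun t : ℝ => x + t • d) d t := by
    simpa using ((hasDerivAt_id t).smul_const d).const_add x
  rw [inner_gradient_left]
  exact hf.hasFDerivAt.comp_hasDerivAt t h1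

/-- A strongly convex function lies above its first-order expansion plus a quadratic. -/
lemma StrongConvexOn.gradient_ineq {s : Set E} {m : ℝ} {f : E → ℝ} (hf : StrongConvexOn s m f)
    {x y : E} (hx : x ∈ s) (hy : y ∈ s) (hd : DifferentiableAt ℝ f x) :
    f x + ⟪gradient f x, y - x⟫ + m / 2 * ‖y - x‖ ^ 2 ≤ f y := by
  have hder : HasDerivAt (fun t : ℝ => f (x + t • (y - x))) ⟪gradient f x, y - x⟫ 0 := by
    have := hasDerivAt_comp_add_smul (f := f) (x := x) (d := y - x) (t := 0) (by simpa using hd)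
    simpa using this
  have h1 := hder.tendsto_slope_zero_right
  have h2 : Tendsto (fun t : ℝ => f y - f x - (1 - t) * (m / 2 * ‖y - x‖ ^ 2)) (𝓝[>] 0)
      (𝓝 (f y - f x - (1 - 0) * (m / 2 * ‖y - x‖ ^ 2))) := by
    refine Tendsto.mono_left ?_ nhdsWithin_le_nhds
    exact Continuous.tendsto (by fun_prop) 0
  have h3 := le_of_tendsto_of_tendsto h1 h2 (by
    filter_upwards [Ioo_mem_nhdsGT (zero_lt_one' ℝ)] with t ht
    have h := hf.2 hx hy (sub_nonneg.2 ht.2.le) ht.1.le (sub_add_cancel 1 t)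
    have e : (1 - t) • x + t • y = x + t • (y - x) := by module
    rw [e, norm_sub_rev x y] at h
    simp only [zero_add, zero_smul, add_zero, smul_eq_mul] at h ⊢
    rw [inv_mul_le_iff₀ ht.1]
    linarith)
  linarith

/-- First-order Taylor estimate for a function with Lipschitz gradient on a convex set. -/
lemma abs_taylor_le_of_lipschitz_gradient {s : Set E} (hs : Convex ℝ s) {L : ℝ} {f : E → ℝ}
    (hd : ∀ x ∈ s, DifferentiableAt ℝ f x)
    (hL : ∀ x ∈ s, ∀ x' ∈ s, ‖gradient f x - gradient f x'‖ ≤ L * ‖x - x'‖)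
    {y z : E} (hy : y ∈ s) (hz : z ∈ s) :
    |f z - f y - ⟪gradient f y, z - y⟫| ≤ L / 2 * ‖z - y‖ ^ 2 := by
  have hmem : ∀ t ∈ Set.Icc (0 : ℝ) 1, y + t • (z - y) ∈ s := fun t ht =>
    hs.add_smul_sub_mem hy hz ht
  have hg : ∀ t ∈ Set.Icc (0 : ℝ) 1, HasDerivAt
      (fun t : ℝ => f (y + t • (z - y)) - f y - t * ⟪gradient f y, z - y⟫)
      (⟪gradient f (y + t • (z - y)), z - y⟫ - ⟪gradient f y, z - y⟫) t := by
    intro t ht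
    have h1 : HasDerivAt (fun t : ℝ => t * ⟪gradient f y, z - y⟫) ⟪gradient f y, z - y⟫ t := by
      simpa using (hasDerivAt_id t).mul_const ⟪gradient f y, z - y⟫
    exact ((hasDerivAt_comp_add_smul (hd _ (hmem t ht))).sub_const (f y)).sub h1
  have key := image_norm_le_of_norm_deriv_right_le_deriv_boundary' (a := (0 : ℝ)) (b := 1)
    (f := fun t : ℝ => f (y + t • (z - y)) - f y - t * ⟪gradient f y, z - y⟫)
    (f' := fun t => ⟪gradient f (y + t • (z - y)), z - y⟫ - ⟪gradient f y, z - y⟫)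
    (B := fun t => L / 2 * ‖z - y‖ ^ 2 * t ^ 2) (B' := fun t => L / 2 * ‖z - y‖ ^ 2 * (2 * t))
    (fun t ht => (hg t ht).continuousAt.continuousWithinAt)
    (fun t ht => (hg t (Set.Ico_subset_Icc_self ht)).hasDerivWithinAt)
    (by simp) (by fun_prop)
    (fun t _ => by
      have := ((hasDerivAt_pow 2 t).const_mul (L / 2 * ‖z - y‖ ^ 2)).hasDerivWithinAt
        (s := Set.Ici t)
      simpa using this)
    (fun t ht => by
      rw [← inner_sub_left]
      refine (norm_inner_le_norm _ _).trans ?_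
      have := hL _ (hmem t (Set.Ico_subset_Icc_self ht)) _ hy
      rw [add_sub_cancel_left, norm_smul, Real.norm_of_nonneg ht.1] at this
      nlinarith [norm_nonneg (z - y)])
    (Set.right_mem_Icc.2 zero_le_one)
  simpa using key

/-- The strong convexity modulus does not exceed the smoothness constant. -/
lemma StrongConvexOn.modulus_le {s : Set E} {m L : ℝ} {f : E → ℝ} (hf : StrongConvexOn s m f)
    (hd : ∀ x ∈ s, DifferentiableAt ℝ f x)
    (hL : ∀ x ∈ s, ∀ x' ∈ s, ‖gradient f x - gradient f x'‖ ≤ L * ‖x - x'‖)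
    {x y : E} (hx : x ∈ s) (hy : y ∈ s) (hxy : x ≠ y) : m ≤ L := by
  have h1 := hf.gradient_ineq hx hy (hd x hx)
  have h2 := (abs_le.1 (abs_taylor_le_of_lipschitz_gradient hf.1 hd hL hx hy)).2
  have h3 : 0 < ‖y - x‖ ^ 2 := by
    have := norm_pos_iff.2 (sub_ne_zero.2 hxy.symm)
    positivity
  nlinarith

/-- Cocoercivity of the gradient of `f - m / 2 * ‖·‖ ^ 2`, with explicit auxiliary points. The
usual proof compares `f` at the points `y - t • a` and `x + t • a`, which have to lie in the set
where `f` is convex and smooth; this is why the estimate is only local. -/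
lemma StrongConvexOn.cocoercive_of_mem {s : Set E} {m L : ℝ} {f : E → ℝ}
    (hf : StrongConvexOn s m f)
    (hd : ∀ x ∈ s, DifferentiableAt ℝ f x)
    (hL : ∀ x ∈ s, ∀ x' ∈ s, ‖gradient f x - gradient f x'‖ ≤ L * ‖x - x'‖)
    {x y a : E} (hx : x ∈ s) (hy : y ∈ s) (t : ℝ)
    (ha : a = gradient f y - gradient f x - m • (y - x))
    (h1 : y - t • a ∈ s) (h2 : x + t • a ∈ s) :
    (2 * t - (L - m) * t ^ 2) * ‖a‖ ^ 2 ≤ ⟪a, y - x⟫ := by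
  have i1 := hf.gradient_ineq hx h1 (hd x hx)
  have i2 := (abs_le.1 (abs_taylor_le_of_lipschitz_gradient hf.1 hd hL hy h1)).2
  have i3 := hf.gradient_ineq hy h2 (hd y hy)
  have i4 := (abs_le.1 (abs_taylor_le_of_lipschitz_gradient hf.1 hd hL hx h2)).2
  have e1 : y - t • a - x = (y - x) - t • a := by abel
  have e3 : x + t • a - y = -((y - x) - t • a) := by abel
  rw [e1] at i1
  rw [e3, norm_neg] at i3
  rw [sub_sub_cancel_left, norm_neg] at i2
  rw [add_sub_cancel_left] at i4
  have hgy : gradient f y = a + gradient f x + m • (y - x) := by rw [ha]; abel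
  rw [hgy] at i2 i3
  generalize y - x = d at *
  simp only [norm_sub_sq_real, norm_smul, mul_pow, inner_add_left, inner_sub_right, inner_neg_right,
    inner_smul_left, inner_smul_right, Real.norm_eq_abs, sq_abs, conj_trivial,
    real_inner_self_eq_norm_sq] at i1 i2 i3 i4
  rw [real_inner_comm a d] at *
  nlinarith

/-- If a map on a convex set is `C`-Lipschitz for points at distance at most `ε`, it is
`C`-Lipschitz. -/
lemma Convex.norm_sub_le_of_local {F G : Type*} [NormedAddCommGroup F] [NormedSpace ℝ F]
    [SeminormedAddCommGroup G]
    {U : Set F} (hU : Convex ℝ U) {g : F → G} {C ε : ℝ} (hε : 0 < ε)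
    (h : ∀ x ∈ U, ∀ y ∈ U, ‖x - y‖ ≤ ε → ‖g x - g y‖ ≤ C * ‖x - y‖)
    {x y : F} (hx : x ∈ U) (hy : y ∈ U) : ‖g x - g y‖ ≤ C * ‖x - y‖ := by
  obtain ⟨N, hN⟩ := exists_nat_gt (‖x - y‖ / ε)
  have hN0 : (0 : ℝ) < N := (div_nonneg (norm_nonneg _) hε.le).trans_lt hN
  set z : ℕ → F := fun i => x + ((i : ℝ) / N) • (y - x) with hz
  have hzU : ∀ i ≤ N, z i ∈ U := fun i hi =>
    hU.add_smul_sub_mem hx hy ⟨by positivity, div_le_one_of_le₀ (by exact_mod_cast hi) hN0.le⟩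
  have hstep : ∀ i, ‖z i - z (i + 1)‖ = ‖x - y‖ / N := by
    intro i
    have : z i - z (i + 1) = (1 / (N : ℝ)) • (x - y) := by
      simp only [hz]; push_cast; match_scalars <;> field_simp <;> ring
    rw [this, norm_smul, Real.norm_of_nonneg (by positivity)]
    ring
  have hsum := dist_le_range_sum_dist (fun i => g (z i)) N
  have hle : ∀ i ∈ Finset.range N, dist (g (z i)) (g (z (i + 1))) ≤ C * (‖x - y‖ / N) := by
    intro i hi
    rw [dist_eq_norm_sub, ← hstep i]
    have hi := Finset.mem_range.1 hi
    refine h _ (hzU i hi.le) _ (hzU (i + 1) hi) ?_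
    rw [hstep, div_le_iff₀ hN0, mul_comm]
    exact ((div_lt_iff₀ hε).1 hN).le
  have h0 : z 0 = x := by simp [hz]
  have h1 : z N = y := by simp [hz, div_self hN0.ne']
  have := hsum.trans (Finset.sum_le_sum hle)
  rw [h0, h1, dist_eq_norm_sub, Finset.sum_const, Finset.card_range, nsmul_eq_mul] at this
  calc _ ≤ _ := this
    _ = _ := by field_simp

/-- The gradient step `x ↦ x - η ∇f(x)` is Lipschitz with constant
`max |1 - η m| |1 - η L|` on a convex set around which `f` is `m`-strongly convex and `L`-smooth.
Since `f` is only controlled near the set, cocoercivity is available for nearby points only;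
convexity of the set globalizes the resulting Lipschitz estimate. -/
theorem StrongConvexOn.norm_gradientStep_sub_le {s U : Set E} {m L r η : ℝ} {f : E → ℝ}
    (hf : StrongConvexOn s m f)
    (hd : ∀ x ∈ s, DifferentiableAt ℝ f x)
    (hL : ∀ x ∈ s, ∀ x' ∈ s, ‖gradient f x - gradient f x'‖ ≤ L * ‖x - x'‖)
    (hm : 0 ≤ m) (hmL : m ≤ L) (hU : Convex ℝ U) (hr : 0 < r)
    (hball : ∀ x ∈ U, Metric.closedBall x r ⊆ s) {x y : E} (hx : x ∈ U) (hy : y ∈ U) :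
    ‖(x - η • gradient f x) - (y - η • gradient f y)‖ ≤
      max |1 - η * m| |1 - η * L| * ‖x - y‖ := by
  have hUs : U ⊆ s := fun x hx => hball x hx (Metric.mem_closedBall_self hr.le)
  -- cocoercivity divides by `L - m`, so the claim is proved for `m + l` with `l > L - m` first
  have main : ∀ l, L - m < l → ‖(x - η • gradient f x) - (y - η • gradient f y)‖ ≤
      max |1 - η * m| |1 - η * (m + l)| * ‖x - y‖ := by
    intro l hl
    have hl0 : 0 < l := by linarith
    have hε : 0 < r * l / (L + m + 1) := div_pos (mul_pos hr hl0) (by linarith)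
    refine hU.norm_sub_le_of_local (g := fun x => x - η • gradient f x) hε ?_ hx hy
    intro y hy x hx hxy
    set a := gradient f y - gradient f x - m • (y - x) with ha
    have hna : ‖a‖ ≤ (L + m) * ‖y - x‖ := by
      refine (norm_sub_le _ _).trans ?_
      rw [norm_smul, Real.norm_of_nonneg hm, add_mul]
      gcongr
      exact hL _ (hUs hy) _ (hUs hx)
    have hta : ‖(1 / l) • a‖ ≤ r := by
      rw [norm_smul, Real.norm_of_nonneg (by positivity), one_div, inv_mul_le_iff₀ hl0]
      rw [le_div_iff₀ (by linarith)] at hxy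
      nlinarith [norm_nonneg (y - x)]
    have hco := hf.cocoercive_of_mem hd hL (hUs hx) (hUs hy) (1 / l) ha
      (hball y hy (by simpa [Metric.mem_closedBall, dist_eq_norm_sub] using hta))
      (hball x hx (by simpa [Metric.mem_closedBall, dist_eq_norm_sub] using hta))
    have hco' : ‖a‖ ^ 2 ≤ l * inner ℝ a (y - x) := by
      have h1 : 1 / l * ‖a‖ ^ 2 ≤ (2 * (1 / l) - (L - m) * (1 / l) ^ 2) * ‖a‖ ^ 2 := by
        gcongr
        have : (L - m) * (1 / l) ^ 2 ≤ l * (1 / l) ^ 2 := by gcongr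
        have e : l * (1 / l) ^ 2 = 1 / l := by field_simp
        linarith
      have h2 := h1.trans hco
      rwa [one_div, inv_mul_le_iff₀ hl0] at h2
    have e : (y - η • gradient f y) - (x - η • gradient f x) =
        (1 - η * m) • (y - x) - η • a := by rw [ha]; module
    simp only [e]
    exact norm_smul_sub_smul_le_max hl0 hco'
  have hlim : Tendsto (fun l : ℝ => max |1 - η * m| |1 - η * (m + l)| * ‖x - y‖) (𝓝[>] (L - m))
      (𝓝 (max |1 - η * m| |1 - η * (m + (L - m))| * ‖x - y‖)) := by
    refine Tendsto.mono_left ?_ nhdsWithin_le_nhds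
    exact Continuous.tendsto (by fun_prop) _
  rw [add_sub_cancel] at hlim
  exact ge_of_tendsto hlim (by filter_upwards [self_mem_nhdsWithin] with l hl using main l hl)

/-- First-order optimality condition for a minimum on a convex set. -/
lemma IsMinOn.inner_gradient_nonneg {U : Set E} (hU : Convex ℝ U) {f : E → ℝ} {u z : E}
    (hmin : IsMinOn f U u) (hu : u ∈ U) (hd : DifferentiableAt ℝ f u) (hz : z ∈ U) :
    0 ≤ ⟪gradient f u, z - u⟫ := by
  rw [inner_gradient_left]
  exact hmin.localize.hasFDerivWithinAt_nonneg hd.hasFDerivAt.hasFDerivWithinAt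
    (sub_mem_posTangentConeAt_of_segment_subset (hU.segment_subset hu hz))

end GradientStep

/-! ### Euclidean projection -/

/-- On a nonempty closed convex set `proj` is the metric projection, characterized by its
variational inequality. -/
lemma proj_spec {p : ℕ} {U : Set (Vec p)} (hne : U.Nonempty) (hcl : IsClosed U)
    (hU : Convex ℝ U) (x : Vec p) :
    proj U x ∈ U ∧ ∀ z ∈ U, inner ℝ (x - proj U x) (z - proj U x) ≤ 0 := by
  obtain ⟨z, hz, hmin⟩ := exists_norm_eq_iInf_of_complete_convex hne hcl.isComplete hU x
  have hbdd : BddBelow (Set.range fun w : U => ‖x - w‖) :=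
    ⟨0, Set.forall_mem_range.2 fun _ => norm_nonneg _⟩
  have hspec : proj U x ∈ U ∧ ∀ z' ∈ U, ‖x - proj U x‖ ≤ ‖x - z'‖ :=
    Classical.epsilon_spec (p := fun z => z ∈ U ∧ ∀ z' ∈ U, ‖x - z‖ ≤ ‖x - z'‖)
      ⟨z, hz, fun z' hz' => hmin ▸ ciInf_le hbdd ⟨z', hz'⟩⟩
  refine ⟨hspec.1, (norm_eq_iInf_iff_real_inner_le_zero hU hspec.1).1 (le_antisymm ?_ ?_)⟩
  · have : Nonempty U := hne.to_subtype
    exact le_ciInf fun z => hspec.2 z z.2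
  · exact ciInf_le hbdd ⟨_, hspec.1⟩

/-- Nonexpansiveness of the projection, with the projections given by their variational
inequalities. -/
lemma norm_sub_le_of_variational {E : Type*} [NormedAddCommGroup E] [InnerProductSpace ℝ E]
    {a b x y : E} (hx : inner ℝ (a - x) (y - x) ≤ 0) (hy : inner ℝ (b - y) (x - y) ≤ 0) :
    ‖x - y‖ ≤ ‖a - b‖ := by
  have h : ‖x - y‖ ^ 2 ≤ inner ℝ (a - b) (x - y) := by
    have e : inner ℝ (a - b) (x - y) - ‖x - y‖ ^ 2 =
        -(inner ℝ (a - x) (y - x)) - inner ℝ (b - y) (x - y) := by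
      rw [← real_inner_self_eq_norm_sq, ← inner_neg_right, neg_sub, ← inner_sub_left,
        ← inner_sub_left]
      congr 1; abel
    linarith
  have h2 := real_inner_le_norm (a - b) (x - y)
  by_contra! hlt
  nlinarith [norm_nonneg (x - y), norm_nonneg (a - b)]

lemma continuous_proj {p : ℕ} {U : Set (Vec p)} (hne : U.Nonempty) (hcl : IsClosed U)
    (hU : Convex ℝ U) : Continuous (proj U) := by
  refine (LipschitzWith.of_dist_le_mul (K := 1) fun x y => ?_).continuous
  have hx := proj_spec hne hcl hU x
  have hy := proj_spec hne hcl hU y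
  simpa [dist_eq_norm_sub] using
    norm_sub_le_of_variational (hx.2 _ hy.1) (hy.2 _ hx.1)

/-! ### Moments of the uniform distribution on the sphere -/

section UniformSphere

open scoped Pointwise

variable {p : ℕ}

lemma isProbabilityMeasure_uniformSphere (hp : 0 < p) :
    IsProbabilityMeasure (uniformSphere p) := by
  have : Nonempty (Fin p) := ⟨⟨0, hp⟩⟩
  have h0 : (volume : Measure (Vec p)).toSphere Set.univ ≠ 0 := by
    simp [hp.ne', (Metric.measure_ball_pos volume (0 : Vec p) one_pos).ne']
  refine ⟨?_⟩
  rw [uniformSphere, Measure.map_apply measurable_subtype_coe .univ, Set.preimage_univ,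
    Measure.smul_apply, smul_eq_mul]
  exact ENNReal.inv_mul_cancel h0 (measure_ne_top _ _)

lemma ae_norm_eq_one_uniformSphere : ∀ᵐ v ∂(uniformSphere p), ‖v‖ = 1 := by
  rw [uniformSphere, ae_map_iff measurable_subtype_coe.aemeasurable
    (measurableSet_eq_fun measurable_norm measurable_const)]
  exact Filter.Eventually.of_forall fun v => norm_eq_of_mem_sphere v

/-- The mass of a set is proportional to the volume of the cone over its trace on the sphere. -/
lemma uniformSphere_apply {s : Set (Vec p)} (hs : MeasurableSet s) :
    uniformSphere p s = ((volume : Measure (Vec p)).toSphere Set.univ)⁻¹ *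
      (Module.finrank ℝ (Vec p) *
        volume (Set.Ioo (0 : ℝ) 1 • (Metric.sphere (0 : Vec p) 1 ∩ s))) := by
  rw [uniformSphere, Measure.map_apply measurable_subtype_coe hs, Measure.smul_apply, smul_eq_mul,
    Measure.toSphere_apply' _ (measurable_subtype_coe hs), Subtype.image_preimage_coe]

/-- Rotation invariance, inherited from Lebesgue measure on the cone over a set. -/
lemma measurePreserving_uniformSphere (A : Vec p ≃ₗᵢ[ℝ] Vec p) :
    MeasurePreserving A (uniformSphere p) (uniformSphere p) := by
  refine ⟨A.continuous.measurable, Measure.ext fun s hs => ?_⟩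
  rw [Measure.map_apply A.continuous.measurable hs, uniformSphere_apply hs,
    uniformSphere_apply (A.continuous.measurable hs)]
  have hset : Set.Ioo (0 : ℝ) 1 • (Metric.sphere (0 : Vec p) 1 ∩ A ⁻¹' s) =
      A ⁻¹' (Set.Ioo (0 : ℝ) 1 • (Metric.sphere (0 : Vec p) 1 ∩ s)) := by
    ext x
    simp only [Set.mem_preimage, Set.mem_smul, Set.mem_inter_iff, mem_sphere_zero_iff_norm]
    constructor
    · rintro ⟨r, hr, y, ⟨hy, hys⟩, rfl⟩
      exact ⟨r, hr, A y, ⟨by simpa using hy, hys⟩, by simp⟩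
    · rintro ⟨r, hr, y, ⟨hy, hys⟩, h⟩
      refine ⟨r, hr, A.symm y, ⟨by simpa using hy, by simpa using hys⟩, ?_⟩
      rw [← map_smul, h, A.symm_apply_apply]
  rw [hset]
  congr 2
  exact A.measurePreserving.measure_preimage_emb A.toHomeomorph.measurableEmbedding _

lemma integral_comp_uniformSphere {F : Type*} [NormedAddCommGroup F] [NormedSpace ℝ F]
    (A : Vec p ≃ₗᵢ[ℝ] Vec p) (f : Vec p → F) :
    ∫ v, f (A v) ∂(uniformSphere p) = ∫ v, f v ∂(uniformSphere p) :=
  (measurePreserving_uniformSphere A).integral_comp A.toHomeomorph.measurableEmbedding f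

/-- A measurable function that is bounded on the unit sphere is integrable. -/
lemma integrable_uniformSphere_of_bound {F : Type*} [NormedAddCommGroup F] (hp : 0 < p)
    {f : Vec p → F} (hf : AEStronglyMeasurable f (uniformSphere p)) {C : ℝ}
    (hC : ∀ v, ‖v‖ = 1 → ‖f v‖ ≤ C) :
    Integrable f (uniformSphere p) := by
  have := isProbabilityMeasure_uniformSphere hp
  exact Integrable.of_bound hf C (ae_norm_eq_one_uniformSphere.mono hC)

/-- A continuous function is integrable for the uniform distribution on the sphere. -/
lemma Continuous.integrable_uniformSphere {F : Type*} [NormedAddCommGroup F] (hp : 0 < p)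
    {f : Vec p → F} (hf : Continuous f) : Integrable f (uniformSphere p) := by
  obtain ⟨C, hC⟩ := (isCompact_sphere (0 : Vec p) 1).exists_bound_of_continuousOn hf.continuousOn
  exact integrable_uniformSphere_of_bound hp hf.aestronglyMeasurable
    fun v hv => hC v (mem_sphere_zero_iff_norm.2 hv)

lemma integral_id_uniformSphere : ∫ v, v ∂(uniformSphere p) = 0 := by
  have h := integral_comp_uniformSphere (LinearIsometryEquiv.neg ℝ) (fun v : Vec p => v)
  simp only [LinearIsometryEquiv.coe_neg] at h
  rw [integral_neg (f := fun v : Vec p => v)] at h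
  have h2 : (2 : ℝ) • ∫ v, v ∂(uniformSphere p) = 0 := by
    rw [two_smul]
    nth_rw 1 [← h]
    exact neg_add_cancel _
  exact (smul_eq_zero.1 h2).resolve_left two_ne_zero

lemma integrable_coord_mul_coord (hp : 0 < p) (i j : Fin p) :
    Integrable (fun v : Vec p => v i * v j) (uniformSphere p) := by
  refine integrable_uniformSphere_of_bound hp (by fun_prop) (C := 1) fun v hv => ?_
  have h1 := PiLp.norm_apply_le v i
  have h2 := PiLp.norm_apply_le v j
  rw [hv] at h1 h2
  rw [norm_mul]
  exact mul_le_one₀ h1 (norm_nonneg _) h2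

lemma integral_coord_mul_coord_of_ne {i j : Fin p} (hij : i ≠ j) :
    ∫ v : Vec p, v i * v j ∂(uniformSphere p) = 0 := by
  classical
  -- flip the sign of the `i`-th coordinate
  have h := integral_comp_uniformSphere (LinearIsometryEquiv.piLpCongrRight 2 fun k : Fin p =>
    if k = i then LinearIsometryEquiv.neg ℝ else LinearIsometryEquiv.refl ℝ ℝ)
    (fun v : Vec p => v i * v j)
  simp only [LinearIsometryEquiv.piLpCongrRight_apply, if_true, if_neg hij.symm,
    LinearIsometryEquiv.coe_neg, LinearIsometryEquiv.coe_refl, id, neg_mul, integral_neg] at h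
  exact self_eq_neg.1 h.symm

lemma integral_coord_sq (hp : 0 < p) (i : Fin p) :
    ∫ v : Vec p, v i * v i ∂(uniformSphere p) = 1 / p := by
  have := isProbabilityMeasure_uniformSphere hp
  -- by symmetry all coordinates have the same second moment, and these moments add up to one
  have hsymm : ∀ j, ∫ v : Vec p, v j * v j ∂(uniformSphere p) =
      ∫ v : Vec p, v i * v i ∂(uniformSphere p) := by
    intro j
    have h := integral_comp_uniformSphere
      (LinearIsometryEquiv.piLpCongrLeft 2 ℝ ℝ (Equiv.swap i j)) (fun v : Vec p => v i * v i)
    simpa [LinearIsometryEquiv.piLpCongrLeft_apply] using h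
  have hsum : ∑ j, ∫ v : Vec p, v j * v j ∂(uniformSphere p) = 1 := by
    rw [← integral_finsetSum _ fun j _ => integrable_coord_mul_coord hp j j]
    rw [integral_congr_ae (g := fun _ => (1 : ℝ))]
    · simp
    · filter_upwards [ae_norm_eq_one_uniformSphere] with v hv
      have := EuclideanSpace.real_norm_sq_eq v
      rw [hv] at this
      simpa [sq] using this.symm
  rw [Finset.sum_congr rfl fun j _ => hsymm j, Finset.sum_const, Finset.card_univ, Fintype.card_fin,
    nsmul_eq_mul] at hsum
  rw [eq_div_iff (by positivity)]
  linarith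

lemma integrable_inner_smul_uniformSphere (hp : 0 < p) (g : Vec p) :
    Integrable (fun v : Vec p => (inner ℝ g v : ℝ) • v) (uniformSphere p) := by
  refine integrable_uniformSphere_of_bound hp (by fun_prop) (C := ‖g‖) fun v hv => ?_
  rw [norm_smul, hv, mul_one]
  simpa [hv] using norm_inner_le_norm (𝕜 := ℝ) g v

/-- The uniform distribution on the unit sphere of `ℝᵖ` is isotropic: `E[v vᵀ] = I / p`. -/
lemma integral_inner_smul_uniformSphere (hp : 0 < p) (g : Vec p) :
    ∫ v, (inner ℝ g v : ℝ) • v ∂(uniformSphere p) = (1 / (p : ℝ)) • g := by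
  ext i
  have h1 := (EuclideanSpace.proj (𝕜 := ℝ) i).integral_comp_comm
    (integrable_inner_smul_uniformSphere hp g)
  simp only [PiLp.proj_apply, PiLp.smul_apply, smul_eq_mul] at h1 ⊢
  rw [← h1]
  simp only [PiLp.inner_apply, Finset.sum_mul, RCLike.inner_apply, conj_trivial]
  have e : ∀ (v : Vec p) (j : Fin p), v j * g j * v i = g j * (v j * v i) := fun v j => by ring
  simp only [e]
  rw [integral_finsetSum _ fun j _ => (integrable_coord_mul_coord hp j i).const_mul _]
  simp only [integral_const_mul]
  rw [Finset.sum_eq_single i (fun j _ hj => by rw [integral_coord_mul_coord_of_ne hj, mul_zero])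
    (by simp), integral_coord_sq hp, mul_comm]

end UniformSphere

/-! ### The one-point residual gradient estimator -/

/-- A random vector bounded by `B` is within `B` of its mean, in mean norm: the mean distance is
at most the square root of the variance, and the variance is at most `E‖X‖² ≤ B²`. -/
lemma integral_norm_sub_integral_le {Ω E : Type*} {mΩ : MeasurableSpace Ω} [NormedAddCommGroup E]
    [InnerProductSpace ℝ E] [CompleteSpace E] {P : Measure Ω} [IsProbabilityMeasure P]
    {X : Ω → E} (hX : AEStronglyMeasurable X P) {B : ℝ} (hB : ∀ᵐ ω ∂P, ‖X ω‖ ≤ B) :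
    ∫ ω, ‖X ω - ∫ ω', X ω' ∂P‖ ∂P ≤ B := by
  have hint : Integrable X P := Integrable.of_bound hX B hB
  set m := ∫ ω, X ω ∂P with hm
  obtain ⟨ω₀, hω₀⟩ := hB.exists
  rcases ((norm_nonneg _).trans hω₀).eq_or_lt with hB0 | hB0
  · have h0 : X =ᵐ[P] 0 := hB.mono fun ω h => by
      rw [← hB0] at h
      exact norm_le_zero_iff.1 h
    have hm0 : m = 0 := by rw [hm, integral_congr_ae h0]; simp
    have : (fun ω => ‖X ω - m‖) =ᵐ[P] fun _ => 0 := h0.mono fun ω h => by simp [h, hm0]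
    rw [integral_congr_ae this]
    simpa using hB0.le
  -- `2 B ‖X - m‖ ≤ ‖X - m‖² + B²` takes the place of Cauchy–Schwarz
  · have hXsq : Integrable (fun ω => ‖X ω‖ ^ 2) P := by
      refine Integrable.of_bound (by fun_prop) (B ^ 2) (hB.mono fun ω h => ?_)
      rw [Real.norm_of_nonneg (by positivity)]
      gcongr
    have hXm : Integrable (fun ω => inner ℝ m (X ω)) P := hint.const_inner m
    have hvar : ∫ ω, ‖X ω - m‖ ^ 2 ∂P = ∫ ω, ‖X ω‖ ^ 2 ∂P - ‖m‖ ^ 2 := by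
      have e : ∀ ω, ‖X ω - m‖ ^ 2 = ‖X ω‖ ^ 2 - 2 * inner ℝ m (X ω) + ‖m‖ ^ 2 := fun ω => by
        rw [norm_sub_sq_real, real_inner_comm]
      have hi : Integrable (fun ω => ‖X ω‖ ^ 2 - 2 * inner ℝ m (X ω)) P :=
        hXsq.sub (hXm.const_mul 2)
      simp only [e]
      rw [integral_add hi (integrable_const _), integral_sub hXsq (hXm.const_mul 2),
        integral_const_mul, integral_inner hint, ← hm, real_inner_self_eq_norm_sq]
      simp
      ring
    have hsq : ∫ ω, ‖X ω‖ ^ 2 ∂P ≤ B ^ 2 := by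
      calc ∫ ω, ‖X ω‖ ^ 2 ∂P ≤ ∫ _, B ^ 2 ∂P :=
            integral_mono_ae hXsq (integrable_const _) (hB.mono fun ω h => by
              simp only; gcongr)
        _ = B ^ 2 := by simp
    have hXmsq : Integrable (fun ω => ‖X ω - m‖ ^ 2) P := by
      have e : ∀ ω, ‖X ω - m‖ ^ 2 = ‖X ω‖ ^ 2 - 2 * inner ℝ m (X ω) + ‖m‖ ^ 2 := fun ω => by
        rw [norm_sub_sq_real, real_inner_comm]
      simp only [e]
      exact (hXsq.sub (hXm.const_mul 2)).add (integrable_const _)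
    have hXn : Integrable (fun ω => ‖X ω - m‖) P := (hint.sub (integrable_const m)).norm
    have hamgm : ∫ ω, 2 * B * ‖X ω - m‖ ∂P ≤ ∫ ω, (‖X ω - m‖ ^ 2 + B ^ 2) ∂P :=
      integral_mono (hXn.const_mul _) (hXmsq.add (integrable_const _)) fun ω => by
        have := two_mul_le_add_sq B ‖X ω - m‖
        simp only
        linarith
    rw [integral_const_mul, integral_add hXmsq (integrable_const _), hvar] at hamgm
    simp only [integral_const, probReal_univ, one_smul] at hamgm
    have : 2 * B * ∫ ω, ‖X ω - m‖ ∂P ≤ 2 * B * B := by nlinarith [sq_nonneg ‖m‖]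
    exact le_of_mul_le_mul_left this (by linarith)

/-- The one-point estimator `(p / δ) (f (w + δ v) - c) v` of `∇f(w)`: its mean differs from the
gradient `g` by at most `L δ p / 2`, by isotropy of `v` and the Taylor estimate, and the estimator
itself is bounded by `2 p G / δ`. -/
lemma integral_norm_estimator_sub_le {p : ℕ} (hp : 0 < p) {f : Vec p → ℝ} (hf : Continuous f)
    {w g : Vec p} {c δ G L : ℝ} (hδ : 0 < δ) (hc : |c| ≤ G)
    (hG : ∀ v : Vec p, ‖v‖ = 1 → |f (w + δ • v)| ≤ G)
    (hL : ∀ v : Vec p, ‖v‖ = 1 →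
      |f (w + δ • v) - f w - δ * inner ℝ g v| ≤ L / 2 * δ ^ 2) :
    ∫ v, ‖((p : ℝ) / δ * (f (w + δ • v) - c)) • v - g‖ ∂(uniformSphere p) ≤
      2 * p * G / δ + L * δ * (p / 2) := by
  have := isProbabilityMeasure_uniformSphere hp
  have hp' : (0 : ℝ) < p := by exact_mod_cast hp
  set X : Vec p → Vec p := fun v => ((p : ℝ) / δ * (f (w + δ • v) - c)) • v with hX
  have hXc : Continuous X := by fun_prop
  have hXb : ∀ v : Vec p, ‖v‖ = 1 → ‖X v‖ ≤ 2 * p * G / δ := by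
    intro v hv
    rw [norm_smul, hv, mul_one, norm_mul, Real.norm_of_nonneg (by positivity), Real.norm_eq_abs]
    have h1 : |f (w + δ • v) - c| ≤ 2 * G := by
      have := abs_sub (f (w + δ • v)) c
      have := hG v hv
      linarith
    calc (p : ℝ) / δ * |f (w + δ • v) - c| ≤ p / δ * (2 * G) := by gcongr
      _ = 2 * p * G / δ := by ring
  have hXi : Integrable X (uniformSphere p) :=
    integrable_uniformSphere_of_bound hp hXc.aestronglyMeasurable hXb
  have hvi : Integrable (fun v : Vec p => v) (uniformSphere p) :=
    integrable_uniformSphere_of_bound hp aestronglyMeasurable_id (C := 1) fun v hv => hv.le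
  set m := ∫ v, X v ∂(uniformSphere p) with hm
  have hbias : ‖m - g‖ ≤ L * δ * (p / 2) := by
    have hYm : m - g = ∫ v, ((p : ℝ) / δ * (f (w + δ • v) - f w - δ * inner ℝ g v)) • v
        ∂(uniformSphere p) := by
      have e : ∀ v : Vec p, ((p : ℝ) / δ * (f (w + δ • v) - f w - δ * inner ℝ g v)) • v =
          X v - ((p : ℝ) / δ * (f w - c)) • v - (p : ℝ) • ((inner ℝ g v : ℝ) • v) := by
        intro v
        simp only [hX]
        match_scalars
        field_simp
        ring
      have hi : Integrable (fun v : Vec p => ((p : ℝ) / δ * (f w - c)) • v) (uniformSphere p) :=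
        hvi.fun_smul _
      have hi' : Integrable (fun v => X v - ((p : ℝ) / δ * (f w - c)) • v) (uniformSphere p) :=
        hXi.sub hi
      have hj : Integrable (fun v : Vec p => (p : ℝ) • ((inner ℝ g v : ℝ) • v))
          (uniformSphere p) := (integrable_inner_smul_uniformSphere hp g).smul (p : ℝ)
      simp only [e]
      rw [integral_sub hi' hj, integral_sub hXi hi, integral_smul, integral_smul,
        integral_id_uniformSphere,
        integral_inner_smul_uniformSphere hp, smul_smul, mul_one_div_cancel hp'.ne', one_smul,
        smul_zero, sub_zero]
    rw [hYm]
    refine (norm_integral_le_of_norm_le_const (C := L * δ * (p / 2)) ?_).trans (by simp)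
    filter_upwards [ae_norm_eq_one_uniformSphere] with v hv
    rw [norm_smul, hv, mul_one, norm_mul, Real.norm_of_nonneg (by positivity), Real.norm_eq_abs]
    calc (p : ℝ) / δ * |f (w + δ • v) - f w - δ * inner ℝ g v| ≤ p / δ * (L / 2 * δ ^ 2) := by
          gcongr; exact hL v hv
      _ = L * δ * (p / 2) := by field_simp
  have hdev : ∫ v, ‖X v - m‖ ∂(uniformSphere p) ≤ 2 * p * G / δ :=
    integral_norm_sub_integral_le hXc.aestronglyMeasurable
      (ae_norm_eq_one_uniformSphere.mono hXb)
  have hXm : Integrable (fun v => ‖X v - m‖) (uniformSphere p) :=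
    (hXi.sub (integrable_const m)).norm
  calc ∫ v, ‖X v - g‖ ∂(uniformSphere p)
      ≤ ∫ v, (‖X v - m‖ + ‖m - g‖) ∂(uniformSphere p) :=
        integral_mono (hXi.sub (integrable_const _)).norm
          (hXm.add (integrable_const _))
          fun v => norm_sub_le_norm_sub_add_norm_sub _ _ _
    _ = ∫ v, ‖X v - m‖ ∂(uniformSphere p) + ‖m - g‖ := by
        rw [integral_add hXm (integrable_const _)]
        simp
    _ ≤ _ := add_le_add hdev hbias

/-- Freezing: if `V` is independent of `Z`, a bound on the mean of `F z V` that holds for almost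
every value `z` of `Z` bounds the mean of `F Z V`. -/
lemma ProbabilityTheory.IndepFun.lintegral_le_of_ae_lintegral_le {Ω A B : Type*}
    {mΩ : MeasurableSpace Ω}
    [MeasurableSpace A] [MeasurableSpace B] {P : Measure Ω} [IsFiniteMeasure P] {Z : Ω → A}
    {V : Ω → B} (h : IndepFun Z V P) (hZ : Measurable Z) (hV : Measurable V)
    {F : A × B → ENNReal} (hF : Measurable F) {C : ENNReal}
    (hC : ∀ᵐ ω ∂P, ∫⁻ b, F (Z ω, b) ∂(P.map V) ≤ C) :
    ∫⁻ ω, F (Z ω, V ω) ∂P ≤ C * P Set.univ := by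
  have h1 : ∫⁻ ω, F (Z ω, V ω) ∂P = ∫⁻ ω, ∫⁻ b, F (Z ω, b) ∂(P.map V) ∂P := by
    rw [← lintegral_map (f := F) hF (hZ.prodMk hV),
      h.map_prod_eq_prod_map_map hZ.aemeasurable hV.aemeasurable,
      lintegral_prod _ hF.aemeasurable,
      lintegral_map (f := fun a => ∫⁻ b, F (a, b) ∂(P.map V)) hF.lintegral_prod_right' hZ]
  rw [h1, ← lintegral_const]
  exact lintegral_mono_ae hC

/-! ### Measurability of gradients and of operator evaluation -/

lemma measurable_gradient_with_param {Ω A E : Type*} [MeasurableSpace Ω]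
    [TopologicalSpace A] [MeasurableSpace A] [OpensMeasurableSpace A]
    [SecondCountableTopology A]
    [NormedAddCommGroup E] [InnerProductSpace ℝ E] [FiniteDimensional ℝ E] [CompleteSpace E]
    [MeasurableSpace E] [BorelSpace E] {f : A → E → ℝ} (hf : Continuous f.uncurry)
    {a : Ω → A} {x : Ω → E} (ha : Measurable a) (hx : Measurable x) :
    Measurable fun ω => gradient (f (a ω)) (x ω) := by
  have : ProperSpace E := FiniteDimensional.proper ℝ E
  exact (InnerProductSpace.toDual ℝ E).symm.continuous.measurable.comp
    ((measurable_fderiv_with_param ℝ hf).comp (ha.prodMk hx))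

lemma measurable_clm_apply {E F Ω : Type*} [MeasurableSpace Ω]
    [NormedAddCommGroup E] [NormedSpace ℝ E] [FiniteDimensional ℝ E] [MeasurableSpace E]
    [BorelSpace E] [NormedAddCommGroup F] [NormedSpace ℝ F] [SecondCountableTopology F]
    [MeasurableSpace F] [BorelSpace F]
    {H : Ω → E →L[ℝ] F} {x : Ω → E} (hH : Measurable H) (hx : Measurable x) :
    Measurable fun ω => H ω (x ω) := by
  have : ProperSpace E := FiniteDimensional.proper ℝ E
  exact Continuous.measurable2 (c := fun (a : E →L[ℝ] F) b => a b) (by fun_prop) hH hx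

/-! ### The plant and its reduced objectives -/

namespace TVProblem

variable {p q r : ℕ} {S : TVProblem p q r} {μ L M MΦ : ℕ → ℝ} {G τ η δ z₀ : ℝ} {k : ℕ}

lemma closedBall_subset_inflated (hτ : 0 < τ) {x : Vec p} (hx : x ∈ S.U) :
    Metric.closedBall x τ ⊆ S.inflated τ := by
  intro z hz
  rw [Metric.mem_closedBall, dist_eq_norm_sub] at hz
  refine ⟨x, hx, τ⁻¹ • (z - x), ?_, ?_⟩
  · rw [norm_smul, Real.norm_of_nonneg (by positivity), inv_mul_le_iff₀ hτ, mul_one]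
    exact hz
  · rw [smul_inv_smul₀ hτ.ne', add_sub_cancel]

namespace Assumptions

lemma subset_inflated (hS : S.Assumptions μ L M MΦ G τ) : S.U ⊆ S.inflated τ := fun _ hx =>
  closedBall_subset_inflated hS.τ_pos hx (Metric.mem_closedBall_self hS.τ_pos.le)

lemma add_smul_mem_inflated (hS : S.Assumptions μ L M MΦ G τ) (hδ : δ ∈ Set.Ioo 0 τ)
    {w v : Vec p} (hw : w ∈ S.U) (hv : ‖v‖ = 1) : w + δ • v ∈ S.inflated τ := by
  apply closedBall_subset_inflated hS.τ_pos hw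
  rw [Metric.mem_closedBall, dist_eq_norm_sub, add_sub_cancel_left, norm_smul, hv, mul_one,
    Real.norm_of_nonneg hδ.1.le]
  exact hδ.2.le

lemma differentiable_obj (hS : S.Assumptions μ L M MΦ G τ) (k : ℕ) :
    Differentiable ℝ (S.obj k) :=
  (hS.Φ_diff k).comp (differentiable_id.prodMk (hS.h_diff (S.d k)))

/-- Chain rule: with the exact sensitivity, the model-based direction is the gradient of the
reduced objective. -/
lemma modelBasedDir_sensitivity (hS : S.Assumptions μ L M MΦ G τ) (k : ℕ) (u : Vec p) :
    S.modelBasedDir k (S.sensitivity k u) u (S.h u (S.d k)) = gradient (S.obj k) u := by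
  refine ext_inner_right ℝ fun x => ?_
  rw [modelBasedDir, inner_add_left, ContinuousLinearMap.adjoint_inner_left, inner_gradient_left,
    inner_gradient_left, inner_gradient_left]
  set y := S.h u (S.d k) with hy
  have hF := (hS.Φ_diff k (u, y)).hasFDerivAt
  have h1 : HasFDerivAt (fun u' => S.Φ k u' y)
      ((fderiv ℝ (fun x : Vec p × Vec q => S.Φ k x.1 x.2) (u, y)).comp
        ((ContinuousLinearMap.id ℝ (Vec p)).prod 0)) u :=
    HasFDerivAt.comp (g := fun x : Vec p × Vec q => S.Φ k x.1 x.2) (f := fun u' => (u', y)) u hF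
      ((hasFDerivAt_id u).prodMk (hasFDerivAt_const y u))
  have h2 : HasFDerivAt (fun y' => S.Φ k u y')
      ((fderiv ℝ (fun x : Vec p × Vec q => S.Φ k x.1 x.2) (u, y)).comp
        ((0 : Vec q →L[ℝ] Vec p).prod (ContinuousLinearMap.id ℝ (Vec q)))) y :=
    HasFDerivAt.comp (g := fun x : Vec p × Vec q => S.Φ k x.1 x.2) y hF
      ((hasFDerivAt_const u y).prodMk (hasFDerivAt_id y))
  have h3 : HasFDerivAt (S.obj k)
      ((fderiv ℝ (fun x : Vec p × Vec q => S.Φ k x.1 x.2) (u, y)).comp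
        ((ContinuousLinearMap.id ℝ (Vec p)).prod (S.sensitivity k u))) u :=
    HasFDerivAt.comp (g := fun x : Vec p × Vec q => S.Φ k x.1 x.2) u hF
      ((hasFDerivAt_id u).prodMk (hS.h_diff (S.d k) u).hasFDerivAt)
  rw [h1.fderiv, h2.fderiv, h3.fderiv]
  simp [← map_add]

/-- Only the sensitivity enters the error of the model-based direction at the current input. -/
lemma norm_modelBasedDir_sub_gradient_le (hS : S.Assumptions μ L M MΦ G τ) (k : ℕ)
    (H : Vec p →L[ℝ] Vec q) {u : Vec p} (hu : u ∈ S.inflated τ) :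
    ‖S.modelBasedDir k H u (S.h u (S.d k)) - gradient (S.obj k) u‖ ≤
      MΦ k * ‖H - S.sensitivity k u‖ := by
  rw [← hS.modelBasedDir_sensitivity, modelBasedDir, modelBasedDir, add_sub_add_left_eq_sub,
    ← sub_apply, ← map_sub]
  refine (ContinuousLinearMap.le_opNorm _ _).trans ?_
  rw [LinearIsometryEquiv.norm_map, mul_comm]
  rcases subsingleton_or_nontrivial (Vec q) with hq | hq
  · -- without outputs `MΦ k` may be negative, but then the sensitivity error vanishes
    have : H - S.sensitivity k u = 0 := ContinuousLinearMap.ext fun x => Subsingleton.elim _ _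
    simp [this]
  · obtain ⟨y₁, y₂, hy⟩ := exists_pair_ne (Vec q)
    have h0 : 0 ≤ MΦ k := by
      have h1 := (abs_nonneg _).trans (hS.Φ_lipschitz k u hu y₁ y₂)
      exact nonneg_of_mul_nonneg_left h1 (norm_pos_iff.2 (sub_ne_zero.2 hy))
    gcongr
    have hlip : LipschitzWith ⟨MΦ k, h0⟩ fun y => S.Φ k u y :=
      LipschitzWith.of_dist_le_mul fun y y' => by
        rw [Real.dist_eq, dist_eq_norm_sub]
        exact hS.Φ_lipschitz k u hu y y'
    rw [gradient, LinearIsometryEquiv.norm_map]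
    exact norm_fderiv_le_of_lipschitz ℝ hlip

lemma norm_gradient_perturbed_sub_le (hS : S.Assumptions μ L M MΦ G τ) {w v : Vec p}
    (hδ : δ ∈ Set.Ioo 0 τ) (hw : w ∈ S.U) (hv : ‖v‖ = 1) :
    ‖gradient (S.obj k) (w + δ • v) - gradient (S.obj k) w‖ ≤ L k * δ := by
  refine ((hS.obj_smooth k).2 _ (hS.add_smul_mem_inflated hδ hw hv) _
    (hS.subset_inflated hw)).trans_eq ?_
  rw [add_sub_cancel_left, norm_smul, hv, mul_one, Real.norm_of_nonneg hδ.1.le]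

/-- Uses that `U_τ` contains a nondegenerate ball. -/
lemma μ_le_L (hS : S.Assumptions μ L M MΦ G τ) (hp : 0 < p) (hne : S.U.Nonempty) (k : ℕ) :
    μ k ≤ L k := by
  obtain ⟨x, hx⟩ := hne
  have : Nonempty (Fin p) := ⟨⟨0, hp⟩⟩
  obtain ⟨e, he⟩ := exists_norm_eq (Vec p) (zero_le_one' ℝ)
  have hδ : τ / 2 ∈ Set.Ioo 0 τ := ⟨half_pos hS.τ_pos, half_lt_self hS.τ_pos⟩
  refine (hS.obj_strongConvex k).modulus_le (hS.obj_smooth k).1 (hS.obj_smooth k).2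
    (hS.subset_inflated hx) (hS.add_smul_mem_inflated hδ hx he) fun h => ?_
  have h1 : (τ / 2) • e = 0 := by simpa using h.symm
  rcases smul_eq_zero.1 h1 with h1 | h1
  · exact hδ.1.ne' h1
  · simp [h1] at he

/-- The projected inexact gradient step contracts towards the current optimum up to the error of
the direction, since the optimum is a fixed point of the exact projected gradient step. -/
lemma norm_proj_sub_optimal_le (hS : S.Assumptions μ L M MΦ G τ) (hp : 0 < p) (hη : 0 ≤ η)
    {w g uopt : Vec p} (hw : w ∈ S.U) (hopt : S.IsOptimal k uopt) :
    ‖proj S.U (w - η • g) - uopt‖ ≤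
      max |1 - η * μ k| |1 - η * L k| * ‖w - uopt‖ + η * ‖g - gradient (S.obj k) w‖ := by
  have hpr := proj_spec ⟨w, hw⟩ hS.U_closed hS.U_convex (w - η • g)
  have hfix : inner ℝ (uopt - η • gradient (S.obj k) uopt - uopt)
      (proj S.U (w - η • g) - uopt) ≤ 0 := by
    have hmin : IsMinOn (S.obj k) S.U uopt := fun x hx => hopt.2 x hx
    have := hmin.inner_gradient_nonneg hS.U_convex hopt.1 (hS.differentiable_obj k uopt) hpr.1
    rw [sub_sub_cancel_left, inner_neg_left, real_inner_smul_left]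
    nlinarith
  refine (norm_sub_le_of_variational (hpr.2 _ hopt.1) hfix).trans ?_
  have hstep := (hS.obj_strongConvex k).norm_gradientStep_sub_le (η := η) (hS.obj_smooth k).1
    (hS.obj_smooth k).2 (hS.μ_pos k).le (hS.μ_le_L hp ⟨w, hw⟩ k) hS.U_convex hS.τ_pos
    (fun x hx => closedBall_subset_inflated hS.τ_pos hx) hw hopt.1
  have e : w - η • g - (uopt - η • gradient (S.obj k) uopt) =
      (w - η • gradient (S.obj k) w - (uopt - η • gradient (S.obj k) uopt)) -
        η • (g - gradient (S.obj k) w) := by module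
  rw [e]
  refine (norm_sub_le _ _).trans ?_
  rw [norm_smul, Real.norm_of_nonneg hη]
  gcongr

/-- Mean error of the model-free direction for a frozen past: current iterate `w`, previous
objective value `c`. -/
lemma integral_norm_modelFree_sub_gradient_le (hS : S.Assumptions μ L M MΦ G τ) (hp : 0 < p)
    (hδ : δ ∈ Set.Ioo 0 τ) (k : ℕ) {w : Vec p} (hw : w ∈ S.U) {c : ℝ} (hc : |c| ≤ G) :
    ∫ v, ‖((p : ℝ) / δ * (S.obj k (w + δ • v) - c)) • v - gradient (S.obj k) w‖
      ∂(uniformSphere p) ≤ 2 * p * G / δ + L k * δ * (p / 2) := by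
  refine integral_norm_estimator_sub_le hp (hS.differentiable_obj k).continuous hδ.1 hc
    (fun v hv => hS.obj_bounded _ (hS.add_smul_mem_inflated hδ hw hv) k) fun v hv => ?_
  have h := abs_taylor_le_of_lipschitz_gradient (hS.obj_strongConvex k).1 (hS.obj_smooth k).1
    (hS.obj_smooth k).2 (hS.subset_inflated hw) (hS.add_smul_mem_inflated hδ hw hv)
  rwa [add_sub_cancel_left, inner_smul_right, norm_smul, hv, mul_one,
    Real.norm_of_nonneg hδ.1.le] at h


/-! ### Measurability and independence in the closed loop -/

lemma measurable_gradient_obj (k : ℕ) : Measurable (gradient (S.obj k)) :=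
  (InnerProductSpace.toDual ℝ (Vec p)).symm.continuous.measurable.comp (measurable_fderiv ℝ _)

lemma measurable_modelBasedDir (hS : S.Assumptions μ L M MΦ G τ) {Ω : Type*} [MeasurableSpace Ω]
    {H : Ω → Vec p →L[ℝ] Vec q} {u : Ω → Vec p} {y : Ω → Vec q}
    (hH : Measurable H) (hu : Measurable u) (hy : Measurable y) (k : ℕ) :
    Measurable fun ω => S.modelBasedDir k (H ω) (u ω) (y ω) := by
  have hΦ : Continuous fun x : Vec p × Vec q => S.Φ k x.1 x.2 := (hS.Φ_diff k).continuous
  have h1 := measurable_gradient_with_param (f := fun (y : Vec q) (u : Vec p) => S.Φ k u y)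
    (hΦ.comp continuous_swap) hy hu
  have h2 := measurable_gradient_with_param (f := fun (u : Vec p) (y : Vec q) => S.Φ k u y)
    hΦ hu hy
  have h3 : Measurable fun ω => ContinuousLinearMap.adjoint (H ω) :=
    (ContinuousLinearMap.adjoint (𝕜 := ℝ) (E := Vec p) (F := Vec q)).continuous.measurable.comp hH
  simp only [modelBasedDir]
  exact h1.add (measurable_clm_apply h3 h2)

/-- The gray-box direction is a measurable function of the iterate `w`, the exploration `v`, the
approximate sensitivity `H` and the previous objective value `c`, for any `σ`-algebra on `Ω`. -/
lemma measurable_direction (hS : S.Assumptions μ L M MΦ G τ) {Ω : Type*} [MeasurableSpace Ω]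
    {α : ℝ} {w v φ : Ω → Vec p} {H : Ω → Vec p →L[ℝ] Vec q} {c : Ω → ℝ}
    (hw : Measurable w) (hv : Measurable v) (hH : Measurable H) (hc : Measurable c)
    (hφ : ∀ ω, φ ω = α • S.modelBasedDir k (H ω) (w ω + δ • v ω)
        (S.h (w ω + δ • v ω) (S.d k)) +
      (1 - α) • ((p : ℝ) / δ * (S.obj k (w ω + δ • v ω) - c ω)) • v ω) :
    Measurable φ := by
  have hu : Measurable fun ω => w ω + δ • v ω := by fun_prop
  have h1 := (hS.h_diff (S.d k)).continuous.measurable.comp hu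
  have h2 := hS.measurable_modelBasedDir hH hu h1 k
  have h3 := (hS.differentiable_obj k).continuous.measurable.comp hu
  rw [funext hφ]
  exact (h2.const_smul α).add ((((h3.sub hc).const_mul _).smul hv).const_smul (1 - α))

end Assumptions

/-- The closed loop in terms of the iterates `w` alone. -/
lemma IsClosedLoop.direction_eq {α : ℕ → ℝ} {w₀ : Vec p} {v : ℕ → Vec p}
    {Hhat : ℕ → Vec p →L[ℝ] Vec q} {w u : ℕ → Vec p} {y : ℕ → Vec q} {φ : ℕ → Vec p}
    (h : S.IsClosedLoop η δ z₀ α w₀ v Hhat w u y φ) (k : ℕ) :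
    φ k = α k • S.modelBasedDir k (Hhat k) (w k + δ • v k) (S.h (w k + δ • v k) (S.d k)) +
      (1 - α k) • ((p : ℝ) / δ * (S.obj k (w k + δ • v k) - S.prevValue z₀ u y k)) • v k := by
  rw [h.φ_eq, modelFreeDir, h.y_eq, h.u_eq]
  rfl

lemma IsClosedLoop.prevValue_succ {α : ℕ → ℝ} {w₀ : Vec p} {v : ℕ → Vec p}
    {Hhat : ℕ → Vec p →L[ℝ] Vec q} {w u : ℕ → Vec p} {y : ℕ → Vec q} {φ : ℕ → Vec p}
    (h : S.IsClosedLoop η δ z₀ α w₀ v Hhat w u y φ) (k : ℕ) :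
    S.prevValue z₀ u y (k + 1) = S.obj k (w k + δ • v k) := by
  rw [prevValue, h.y_eq, h.u_eq]
  rfl

lemma IsClosedLoop.iterate_mem (hS : S.Assumptions μ L M MΦ G τ) {α : ℕ → ℝ} {w₀ : Vec p}
    (hw₀ : w₀ ∈ S.U) {v : ℕ → Vec p}
    {Hhat : ℕ → Vec p →L[ℝ] Vec q} {w u : ℕ → Vec p} {y : ℕ → Vec q} {φ : ℕ → Vec p}
    (h : S.IsClosedLoop η δ z₀ α w₀ v Hhat w u y φ) (k : ℕ) : w k ∈ S.U := by
  cases k with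
  | zero => rwa [h.w_zero]
  | succ k =>
    rw [h.w_succ]
    exact (proj_spec ⟨w₀, hw₀⟩ hS.U_closed hS.U_convex _).1

section Stochastic

variable {Ω : Type*} {mΩ : MeasurableSpace Ω} {P : Measure Ω} {ℱ : Filtration ℕ mΩ}
  {α : ℕ → ℝ} {w₀ : Vec p}
  {v : ℕ → Ω → Vec p} {Hhat : ℕ → Ω → Vec p →L[ℝ] Vec q}
  {w u : ℕ → Ω → Vec p} {y : ℕ → Ω → Vec q} {φ : ℕ → Ω → Vec p}

/-- The state before the exploration at time `k + 1` is known at time `k`. -/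
lemma measurable_state (hS : S.Assumptions μ L M MΦ G τ) (hw₀ : w₀ ∈ S.U)
    (hv : ∀ k, Measurable[ℱ k] (v k)) (hHhat : ∀ k, Measurable[ℱ k] (Hhat k))
    (hloop : ∀ ω, S.IsClosedLoop η δ z₀ α w₀ (fun k => v k ω) (fun k => Hhat k ω)
      (fun k => w k ω) (fun k => u k ω) (fun k => y k ω) (fun k => φ k ω)) (k : ℕ) :
    Measurable[ℱ k] fun ω =>
      (w (k + 1) ω, S.prevValue z₀ (fun k => u k ω) (fun k => y k ω) (k + 1)) := by
  have step : ∀ k, (Measurable[ℱ k] (w k)) →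
      (Measurable[ℱ k] fun ω => S.prevValue z₀ (fun k => u k ω) (fun k => y k ω) k) →
      Measurable[ℱ k] fun ω =>
        (w (k + 1) ω, S.prevValue z₀ (fun k => u k ω) (fun k => y k ω) (k + 1)) := by
    intro k hw hc
    have hφ : Measurable[ℱ k] (φ k) :=
      @Assumptions.measurable_direction p q r S μ L M MΦ G τ δ k hS Ω (ℱ k) (α k) (w k) (v k) (φ k)
        (Hhat k) _ hw (hv k) (hHhat k) hc fun ω => (hloop ω).direction_eq k
    have h1 : Measurable[ℱ k] fun ω => w (k + 1) ω := by
      have e : (fun ω => w (k + 1) ω) = fun ω => proj S.U (w k ω - η • φ k ω) :=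
        funext fun ω => (hloop ω).w_succ k
      rw [e]
      exact (continuous_proj ⟨w₀, hw₀⟩ hS.U_closed hS.U_convex).measurable.comp
        (hw.sub (hφ.const_smul η))
    have h2 : Measurable[ℱ k]
        fun ω => S.prevValue z₀ (fun k => u k ω) (fun k => y k ω) (k + 1) := by
      simp only [fun ω => (hloop ω).prevValue_succ k]
      exact (hS.differentiable_obj k).continuous.measurable.comp
        (hw.add ((hv k).const_smul δ))
    exact h1.prodMk h2
  induction k with
  | zero =>
    refine step 0 ?_ ?_
    · rw [show w 0 = fun _ => w₀ from funext fun ω => (hloop ω).w_zero]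
      exact measurable_const
    · exact measurable_const
  | succ k ih =>
    have hle : ℱ k ≤ ℱ (k + 1) := ℱ.mono k.le_succ
    exact step (k + 1) ((measurable_fst.comp ih).mono hle le_rfl)
      ((measurable_snd.comp ih).mono hle le_rfl)

/-- The state at time `k` is measurable and independent of the exploration vector at time `k`. -/
lemma measurable_and_indepFun_state (hS : S.Assumptions μ L M MΦ G τ) (hw₀ : w₀ ∈ S.U)
    [IsProbabilityMeasure P]
    (hv : IsExploration P ℱ v) (hHhat : ∀ k, Measurable[ℱ k] (Hhat k))
    (hloop : ∀ ω, S.IsClosedLoop η δ z₀ α w₀ (fun k => v k ω) (fun k => Hhat k ω)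
      (fun k => w k ω) (fun k => u k ω) (fun k => y k ω) (fun k => φ k ω)) (k : ℕ) :
    (Measurable fun ω => (w k ω, S.prevValue z₀ (fun k => u k ω) (fun k => y k ω) k)) ∧
    IndepFun (fun ω => (w k ω, S.prevValue z₀ (fun k => u k ω) (fun k => y k ω) k)) (v k) P := by
  cases k with
  | zero =>
    simp only [fun ω => (hloop ω).w_zero, prevValue]
    exact ⟨measurable_const, indepFun_const_left _ _⟩
  | succ k =>
    have h := measurable_state hS hw₀ hv.adapted hHhat hloop k
    refine ⟨h.mono (ℱ.le k) le_rfl, ?_⟩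
    rw [IndepFun_iff_Indep]
    exact indep_of_indep_of_le_left (hv.indep k) h.comap_le

end Stochastic

end TVProblem

/-! ### Mean error of the gray-box direction -/

namespace TVProblem

variable {p q r : ℕ} {S : TVProblem p q r} {μ L M MΦ : ℕ → ℝ} {G τ η δ z₀ : ℝ} {k : ℕ}
  {Ω : Type*} {mΩ : MeasurableSpace Ω} {P : Measure Ω}

lemma ae_norm_eq_one_of_map_eq {V : Ω → Vec p} (hV : Measurable V)
    (hlaw : P.map V = uniformSphere p) : ∀ᵐ ω ∂P, ‖V ω‖ = 1 :=
  ae_of_ae_map hV.aemeasurable (hlaw ▸ ae_norm_eq_one_uniformSphere)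

namespace Assumptions

variable [IsProbabilityMeasure P]

/-- The model-based direction errs by the sensitivity error, times the Lipschitz constant of the
objective in the output, and by evaluating the gradient at the perturbed input. -/
lemma integral_norm_modelBased_sub_gradient_le (hS : S.Assumptions μ L M MΦ G τ)
    (hδ : δ ∈ Set.Ioo 0 τ) (k : ℕ) {w V : Ω → Vec p} {H : Ω → Vec p →L[ℝ] Vec q}
    (hw : Measurable w) (hV : Measurable V) (hH : Measurable H)
    (hlaw : P.map V = uniformSphere p) (hwU : ∀ ω, w ω ∈ S.U)
    (hε : Integrable (fun ω => ‖H ω - S.sensitivity k (w ω + δ • V ω)‖) P) :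
    Integrable (fun ω => ‖S.modelBasedDir k (H ω) (w ω + δ • V ω)
      (S.h (w ω + δ • V ω) (S.d k)) - gradient (S.obj k) (w ω)‖) P ∧
    ∫ ω, ‖S.modelBasedDir k (H ω) (w ω + δ • V ω)
      (S.h (w ω + δ • V ω) (S.d k)) - gradient (S.obj k) (w ω)‖ ∂P ≤
      MΦ k * (∫ ω, ‖H ω - S.sensitivity k (w ω + δ • V ω)‖ ∂P) + L k * δ := by
  have hu : Measurable fun ω => w ω + δ • V ω := by fun_prop
  have hmeas : Measurable fun ω => ‖S.modelBasedDir k (H ω) (w ω + δ • V ω)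
      (S.h (w ω + δ • V ω) (S.d k)) - gradient (S.obj k) (w ω)‖ :=
    ((hS.measurable_modelBasedDir hH hu ((hS.h_diff (S.d k)).continuous.measurable.comp hu) k).sub
      ((measurable_gradient_obj k).comp hw)).norm
  have hbound : ∀ᵐ ω ∂P, ‖S.modelBasedDir k (H ω) (w ω + δ • V ω)
      (S.h (w ω + δ • V ω) (S.d k)) - gradient (S.obj k) (w ω)‖ ≤
      MΦ k * ‖H ω - S.sensitivity k (w ω + δ • V ω)‖ + L k * δ := by
    filter_upwards [ae_norm_eq_one_of_map_eq hV hlaw] with ω hω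
    exact (norm_sub_le_norm_sub_add_norm_sub _ _ _).trans (add_le_add
      (hS.norm_modelBasedDir_sub_gradient_le k (H ω) (hS.add_smul_mem_inflated hδ (hwU ω) hω))
      (hS.norm_gradient_perturbed_sub_le hδ (hwU ω) hω))
  have hint : Integrable (fun ω => MΦ k * ‖H ω - S.sensitivity k (w ω + δ • V ω)‖ + L k * δ) P :=
    (hε.const_mul _).add (integrable_const _)
  have hI := hint.mono' hmeas.aestronglyMeasurable
    (hbound.mono fun ω h => by rwa [norm_norm])
  refine ⟨hI, (integral_mono_ae hI hint hbound).trans_eq ?_⟩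
  rw [integral_add (hε.const_mul _) (integrable_const _), integral_const_mul]
  simp

/-- The bound for a frozen past carries over to the closed loop, since the exploration vector is
independent of the current iterate and of the previous objective value. -/
lemma integral_norm_modelFree_sub_gradient_le_of_indepFun (hS : S.Assumptions μ L M MΦ G τ)
    (hp : 0 < p) (hδ : δ ∈ Set.Ioo 0 τ) (k : ℕ) {w V : Ω → Vec p} {c : Ω → ℝ}
    (hwc : Measurable fun ω => (w ω, c ω)) (hV : Measurable V)
    (hind : IndepFun (fun ω => (w ω, c ω)) V P)
    (hlaw : P.map V = uniformSphere p) (hwU : ∀ ω, w ω ∈ S.U) (hc : ∀ᵐ ω ∂P, |c ω| ≤ G) :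
    Integrable (fun ω => ‖((p : ℝ) / δ * (S.obj k (w ω + δ • V ω) - c ω)) • V ω -
      gradient (S.obj k) (w ω)‖) P ∧
    ∫ ω, ‖((p : ℝ) / δ * (S.obj k (w ω + δ • V ω) - c ω)) • V ω -
      gradient (S.obj k) (w ω)‖ ∂P ≤ 2 * p * G / δ + L k * δ * (p / 2) := by
  set B := 2 * p * G / δ + L k * δ * (p / 2) with hB
  have hobj := (hS.differentiable_obj k).continuous
  have hmeas : Measurable fun x : (Vec p × ℝ) × Vec p =>
      ((p : ℝ) / δ * (S.obj k (x.1.1 + δ • x.2) - x.1.2)) • x.2 - gradient (S.obj k) x.1.1 := by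
    refine Measurable.sub (Continuous.measurable (by fun_prop)) ?_
    exact (measurable_gradient_obj k).comp (measurable_fst.comp measurable_fst)
  have hle : ∫⁻ ω, ‖((p : ℝ) / δ * (S.obj k (w ω + δ • V ω) - c ω)) • V ω -
      gradient (S.obj k) (w ω)‖ₑ ∂P ≤ ENNReal.ofReal B := by
    have h := hind.lintegral_le_of_ae_lintegral_le hwc hV (C := ENNReal.ofReal B)
      (F := fun x => ‖((p : ℝ) / δ * (S.obj k (x.1.1 + δ • x.2) - x.1.2)) • x.2 -
        gradient (S.obj k) x.1.1‖ₑ) hmeas.enorm (by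
      filter_upwards [hc] with ω hω
      rw [hlaw, ← ofReal_integral_norm_eq_lintegral_enorm
        (Continuous.integrable_uniformSphere hp (by fun_prop))]
      exact ENNReal.ofReal_le_ofReal
        (hS.integral_norm_modelFree_sub_gradient_le hp hδ k (hwU ω) hω))
    simpa using h
  have hI : Integrable (fun ω => ((p : ℝ) / δ * (S.obj k (w ω + δ • V ω) - c ω)) • V ω -
      gradient (S.obj k) (w ω)) P :=
    ⟨(hmeas.comp (hwc.prodMk hV)).aestronglyMeasurable, hle.trans_lt ENNReal.ofReal_lt_top⟩
  refine ⟨hI.norm, ?_⟩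
  have hB0 : 0 ≤ B := by
    obtain ⟨ω, hω⟩ := hc.exists
    exact (integral_nonneg fun _ => norm_nonneg _).trans
      (hS.integral_norm_modelFree_sub_gradient_le hp hδ k (hwU ω) hω)
  rw [← ENNReal.ofReal_le_ofReal_iff hB0, ofReal_integral_norm_eq_lintegral_enorm hI]
  exact hle

/-- Mean error of the gray-box direction, a convex combination of the model-based and the
model-free one. -/
lemma integral_norm_direction_sub_gradient_le (hS : S.Assumptions μ L M MΦ G τ)
    (hp : 0 < p) (hδ : δ ∈ Set.Ioo 0 τ) (k : ℕ) {α : ℝ} (hα : α ∈ Set.Icc (0 : ℝ) 1)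
    {w V φ : Ω → Vec p} {H : Ω → Vec p →L[ℝ] Vec q} {c : Ω → ℝ}
    (hwc : Measurable fun ω => (w ω, c ω)) (hV : Measurable V) (hH : Measurable H)
    (hind : IndepFun (fun ω => (w ω, c ω)) V P)
    (hlaw : P.map V = uniformSphere p) (hwU : ∀ ω, w ω ∈ S.U) (hc : ∀ᵐ ω ∂P, |c ω| ≤ G)
    (hε : α ≠ 0 → Integrable (fun ω => ‖H ω - S.sensitivity k (w ω + δ • V ω)‖) P)
    (hφ : ∀ ω, φ ω = α • S.modelBasedDir k (H ω) (w ω + δ • V ω)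
        (S.h (w ω + δ • V ω) (S.d k)) +
      (1 - α) • ((p : ℝ) / δ * (S.obj k (w ω + δ • V ω) - c ω)) • V ω) :
    Integrable (fun ω => ‖φ ω - gradient (S.obj k) (w ω)‖) P ∧
    ∫ ω, ‖φ ω - gradient (S.obj k) (w ω)‖ ∂P ≤
      gammaBound p α (MΦ k) (L k) G δ
        (∫ ω, ‖H ω - S.sensitivity k (w ω + δ • V ω)‖ ∂P) := by
  have hw : Measurable w := measurable_fst.comp hwc
  obtain ⟨hI₂, hle₂⟩ := hS.integral_norm_modelFree_sub_gradient_le_of_indepFun hp hδ k hwc hV hind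
    hlaw hwU hc
  -- for `α = 0` the sensitivity error need not be integrable, but it does not enter
  rcases eq_or_ne α 0 with rfl | hα0
  · simp only [zero_smul, sub_zero, one_smul, zero_add] at hφ
    simp only [hφ]
    exact ⟨hI₂, hle₂.trans_eq (by rw [gammaBound]; ring)⟩
  obtain ⟨hI₁, hle₁⟩ := hS.integral_norm_modelBased_sub_gradient_le hδ k hw hV hH hlaw hwU
    (hε hα0)
  have hbound : ∀ ω, ‖φ ω - gradient (S.obj k) (w ω)‖ ≤
      α * ‖S.modelBasedDir k (H ω) (w ω + δ • V ω) (S.h (w ω + δ • V ω) (S.d k)) -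
        gradient (S.obj k) (w ω)‖ +
      (1 - α) * ‖((p : ℝ) / δ * (S.obj k (w ω + δ • V ω) - c ω)) • V ω -
        gradient (S.obj k) (w ω)‖ := by
    intro ω
    set a := S.modelBasedDir k (H ω) (w ω + δ • V ω) (S.h (w ω + δ • V ω) (S.d k))
    set b := ((p : ℝ) / δ * (S.obj k (w ω + δ • V ω) - c ω)) • V ω
    have e : φ ω - gradient (S.obj k) (w ω) = α • (a - gradient (S.obj k) (w ω)) +
        (1 - α) • (b - gradient (S.obj k) (w ω)) := by rw [hφ ω]; module
    rw [e]
    refine (norm_add_le _ _).trans_eq ?_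
    rw [norm_smul, norm_smul, Real.norm_of_nonneg hα.1, Real.norm_of_nonneg (sub_nonneg.2 hα.2)]
  have hint := (hI₁.const_mul α).add (hI₂.const_mul (1 - α))
  have hmeas : Measurable fun ω => ‖φ ω - gradient (S.obj k) (w ω)‖ :=
    ((hS.measurable_direction hw hV hH (measurable_snd.comp hwc) hφ).sub
      ((measurable_gradient_obj k).comp hw)).norm
  have hI := hint.mono' hmeas.aestronglyMeasurable
    (Filter.Eventually.of_forall fun ω => by rw [norm_norm]; exact hbound ω)
  refine ⟨hI, (integral_mono hI hint hbound).trans ?_⟩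
  simp only [Pi.add_apply]
  rw [integral_add (hI₁.const_mul α) (hI₂.const_mul (1 - α)), integral_const_mul,
    integral_const_mul]
  refine (add_le_add (mul_le_mul_of_nonneg_left hle₁ hα.1)
    (mul_le_mul_of_nonneg_left hle₂ (sub_nonneg.2 hα.2))).trans_eq ?_
  rw [gammaBound]
  ring

/-- A positive step size below `2 / sup L` makes every exact gradient step a contraction. -/
lemma contraction_factor_lt_one (hS : S.Assumptions μ L M MΦ G τ) (hp : 0 < p)
    (hne : S.U.Nonempty) (hη : η ∈ Set.Ioo 0 (2 / ⨆ k, L k)) (k : ℕ) :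
    max |1 - η * μ k| |1 - η * L k| < 1 := by
  have hμ := hS.μ_pos k
  have hμL := hS.μ_le_L hp hne k
  have hLs : L k ≤ ⨆ k, L k := le_ciSup hS.L_bdd k
  have h2 := (lt_div_iff₀ (by linarith)).1 hη.2
  have h3 : η * μ k ≤ η * L k := mul_le_mul_of_nonneg_left hμL hη.1.le
  have h4 : η * L k ≤ η * ⨆ k, L k := mul_le_mul_of_nonneg_left hLs hη.1.le
  have h5 : 0 < η * μ k := mul_pos hη.1 hμ
  rw [max_lt_iff, abs_lt, abs_lt]
  constructor <;> constructor <;> linarith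

end Assumptions

end TVProblem

/-! ### Unrolling the error recursion -/

lemma le_of_affine_recursion {e γ : ℕ → ℝ} {ρ η σ : ℝ} {T : ℕ} (hρ0 : 0 ≤ ρ) (hρ1 : ρ < 1)
    (hσ : 0 ≤ σ) (h : ∀ k < T, e (k + 1) ≤ ρ * e k + η * γ k + σ) :
    e T ≤ ρ ^ T * e 0 + η * ∑ k ∈ Finset.range T, ρ ^ (T - 1 - k) * γ k + σ / (1 - ρ) := by
  have h1 : 0 < 1 - ρ := sub_pos.2 hρ1
  have main : ∀ n ≤ T, e n ≤
      ρ ^ n * e 0 + η * ∑ k ∈ Finset.range n, ρ ^ (n - 1 - k) * γ k + σ / (1 - ρ) := by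
    intro n
    induction n with
    | zero =>
      intro _
      simpa using div_nonneg hσ h1.le
    | succ n ih =>
      intro hn
      have hsum : ∑ k ∈ Finset.range (n + 1), ρ ^ (n + 1 - 1 - k) * γ k =
          ρ * ∑ k ∈ Finset.range n, ρ ^ (n - 1 - k) * γ k + γ n := by
        rw [Finset.sum_range_succ, Finset.mul_sum]
        congr 1
        · refine Finset.sum_congr rfl fun k hk => ?_
          have hk := Finset.mem_range.1 hk
          rw [show n + 1 - 1 - k = (n - 1 - k) + 1 by omega, pow_succ]
          ring
        · simp
      have hgeom : ρ * (σ / (1 - ρ)) + σ = σ / (1 - ρ) := by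
        field_simp
        ring
      rw [hsum, ← hgeom]
      have := mul_le_mul_of_nonneg_left (ih (Nat.le_of_succ_le hn)) hρ0
      have := h n hn
      rw [pow_succ]
      linarith
  exact main T le_rfl

/-! ### Tracking of the time-varying optimum -/

theorem theorem5 {p q r : ℕ} (hp : 0 < p) (S : TVProblem p q r)
    (μ L M MΦ : ℕ → ℝ) (G τ : ℝ) (hS : S.Assumptions μ L M MΦ G τ)
    (η δ : ℝ) (hη : η ∈ Set.Ioo 0 (2 / ⨆ k, L k)) (hδ : δ ∈ Set.Ioo 0 τ)
    (α : ℕ → ℝ) (hα : ∀ k, α k ∈ Set.Icc (0 : ℝ) 1)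
    -- exploration vectors and (causal) approximate sensitivities
    {Ω : Type*} {mΩ : MeasurableSpace Ω} (P : Measure Ω) [IsProbabilityMeasure P]
    (ℱ : Filtration ℕ mΩ)
    (v : ℕ → Ω → Vec p) (hv : IsExploration P ℱ v)
    (Hhat : ℕ → Ω → Vec p →L[ℝ] Vec q) (hHhat : ∀ k, Measurable[ℱ k] (Hhat k))
    -- the closed loop, started at `w₀` with previous objective value `z₀`
    (w₀ : Vec p) (hw₀ : w₀ ∈ S.U) (z₀ : ℝ) (hz₀ : |z₀| ≤ G)
    (w u : ℕ → Ω → Vec p) (y : ℕ → Ω → Vec q) (φ : ℕ → Ω → Vec p)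
    (hloop : ∀ ω, S.IsClosedLoop η δ z₀ α w₀ (fun k => v k ω) (fun k => Hhat k ω)
      (fun k => w k ω) (fun k => u k ω) (fun k => y k ω) (fun k => φ k ω))
    -- the optimal solutions
    (uopt : ℕ → Vec p) (huopt : ∀ k, S.IsOptimal k (uopt k))
    (T : ℕ) (hT : 0 < T)
    -- the sensitivity errors that are used have finite expectation
    (hε : ∀ k < T, α k ≠ 0 → Integrable (fun ω => ‖Hhat k ω - S.sensitivity k (u k ω)‖) P)
    (γ : ℕ → ℝ)
    (hγ : ∀ k, γ k = gammaBound p (α k) (MΦ k) (L k) G δ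
      (∫ ω, ‖Hhat k ω - S.sensitivity k (u k ω)‖ ∂P))
    (ρ : ℝ) (hρ : ρ = ⨆ k : Fin T, max |1 - η * μ k| |1 - η * L k|)
    (σ : ℝ) (hσ : σ = ⨆ k : Fin T, ‖uopt (k + 1) - uopt k‖) :
    (0 ≤ ρ ∧ ρ < 1 ∧ ((∃ k < T, η * μ k ≠ 1 ∨ η * L k ≠ 1) → 0 < ρ)) ∧
    (∀ k < T, Integrable (fun ω => ‖φ k ω - gradient (S.obj k) (w k ω)‖) P ∧
      ∫ ω, ‖φ k ω - gradient (S.obj k) (w k ω)‖ ∂P ≤ γ k) ∧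
    Integrable (fun ω => ‖w T ω - uopt T‖) P ∧
    ∫ ω, ‖w T ω - uopt T‖ ∂P ≤
      ρ ^ T * ‖w₀ - uopt 0‖ + η * ∑ k ∈ Finset.range T, ρ ^ (T - 1 - k) * γ k + σ / (1 - ρ) := by
  have hne : S.U.Nonempty := ⟨w₀, hw₀⟩
  have : Nonempty (Fin T) := ⟨⟨0, hT⟩⟩
  -- suprema over the finite index set
  have hρle : ∀ k < T, max |1 - η * μ k| |1 - η * L k| ≤ ρ := fun k hk => by
    rw [hρ]
    exact le_ciSup (f := fun k : Fin T => max |1 - η * μ k| |1 - η * L k|)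
      (Set.finite_range _).bddAbove ⟨k, hk⟩
  have hσle : ∀ k < T, ‖uopt (k + 1) - uopt k‖ ≤ σ := fun k hk => by
    rw [hσ]
    exact le_ciSup (f := fun k : Fin T => ‖uopt (k + 1) - uopt k‖)
      (Set.finite_range _).bddAbove ⟨k, hk⟩
  have hρ0 : 0 ≤ ρ := ((abs_nonneg _).trans (le_max_left _ _)).trans (hρle 0 hT)
  have hρ1 : ρ < 1 := by
    obtain ⟨k, hk⟩ := exists_eq_ciSup_of_finite
      (f := fun k : Fin T => max |1 - η * μ k| |1 - η * L k|)
    rw [hρ, ← hk]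
    exact hS.contraction_factor_lt_one hp hne hη k
  have hρpos : (∃ k < T, η * μ k ≠ 1 ∨ η * L k ≠ 1) → 0 < ρ := by
    rintro ⟨k, hk, h⟩
    refine lt_of_lt_of_le ?_ (hρle k hk)
    rcases h with h | h
    · exact lt_max_of_lt_left (abs_pos.2 (sub_ne_zero.2 h.symm))
    · exact lt_max_of_lt_right (abs_pos.2 (sub_ne_zero.2 h.symm))
  have hσ0 : 0 ≤ σ := (norm_nonneg _).trans (hσle 0 hT)
  -- the closed loop as a stochastic process
  have hwU : ∀ k ω, w k ω ∈ S.U := fun k ω => (hloop ω).iterate_mem hS hw₀ k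
  have hvm : ∀ k, Measurable (v k) := fun k => (hv.adapted k).mono (ℱ.le k) le_rfl
  have hstate := S.measurable_and_indepFun_state (P := P) hS hw₀ hv hHhat hloop
  have hwm : ∀ k, Measurable (w k) := fun k => measurable_fst.comp (hstate k).1
  have hu : ∀ k ω, u k ω = w k ω + δ • v k ω := fun k ω => (hloop ω).u_eq k
  have hprev : ∀ k, ∀ᵐ ω ∂P,
      |S.prevValue z₀ (fun k => u k ω) (fun k => y k ω) k| ≤ G := by
    intro k
    cases k with
    | zero => exact Filter.Eventually.of_forall fun ω => hz₀
    | succ k =>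
      filter_upwards [TVProblem.ae_norm_eq_one_of_map_eq (hvm k) (hv.law k)] with ω hω
      rw [(hloop ω).prevValue_succ k]
      exact hS.obj_bounded _ (hS.add_smul_mem_inflated hδ (hwU k ω) hω) k
  have herr : ∀ k < T, Integrable (fun ω => ‖φ k ω - gradient (S.obj k) (w k ω)‖) P ∧
      ∫ ω, ‖φ k ω - gradient (S.obj k) (w k ω)‖ ∂P ≤ γ k := by
    intro k hk
    have h := hS.integral_norm_direction_sub_gradient_le hp hδ k (hα k) (hstate k).1 (hvm k)
      ((hHhat k).mono (ℱ.le k) le_rfl) (hstate k).2 (hv.law k) (hwU k) (hprev k)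
      (fun hαk => by simpa only [hu] using hε k hk hαk) (fun ω => (hloop ω).direction_eq k)
    rw [hγ k]
    simpa only [hu] using h
  -- the distance to the optimum is bounded, hence integrable
  have hdist : ∀ k z, z ∈ S.U → Integrable (fun ω => ‖w k ω - z‖) P := by
    intro k z hz
    obtain ⟨D, -, hD⟩ := hS.U_bounded
    refine Integrable.of_bound ((hwm k).sub_const z).norm.aestronglyMeasurable D
      (Filter.Eventually.of_forall fun ω => ?_)
    rw [norm_norm]
    exact hD _ (hwU k ω) _ hz
  have hrec : ∀ k < T, ∫ ω, ‖w (k + 1) ω - uopt (k + 1)‖ ∂P ≤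
      ρ * ∫ ω, ‖w k ω - uopt k‖ ∂P + η * γ k + σ := by
    intro k hk
    obtain ⟨hI, hle⟩ := herr k hk
    have hI₁ := (hdist k (uopt k) (huopt k).1).const_mul ρ
    have hI₂ := hI.const_mul η
    have hpt : ∀ ω, ‖w (k + 1) ω - uopt (k + 1)‖ ≤
        ρ * ‖w k ω - uopt k‖ + η * ‖φ k ω - gradient (S.obj k) (w k ω)‖ + σ := by
      intro ω
      have h1 : ‖w (k + 1) ω - uopt k‖ ≤
          ρ * ‖w k ω - uopt k‖ + η * ‖φ k ω - gradient (S.obj k) (w k ω)‖ := by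
        rw [(hloop ω).w_succ k]
        refine (hS.norm_proj_sub_optimal_le hp hη.1.le (hwU k ω) (huopt k)).trans ?_
        gcongr
        exact hρle k hk
      have h2 := hσle k hk
      rw [norm_sub_rev] at h2
      exact (norm_sub_le_norm_sub_add_norm_sub _ (uopt k) _).trans (add_le_add h1 h2)
    have hI₁₂ : Integrable (fun ω => ρ * ‖w k ω - uopt k‖ +
        η * ‖φ k ω - gradient (S.obj k) (w k ω)‖) P := hI₁.add hI₂
    have h := integral_mono (hdist (k + 1) _ (huopt (k + 1)).1)
      (hI₁₂.add (integrable_const σ)) hpt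
    simp only [Pi.add_apply] at h
    rw [integral_add hI₁₂ (integrable_const σ), integral_add hI₁ hI₂, integral_const_mul,
      integral_const_mul] at h
    simp only [integral_const, probReal_univ, one_smul] at h
    have := mul_le_mul_of_nonneg_left hle hη.1.le
    linarith
  refine ⟨⟨hρ0, hρ1, hρpos⟩, herr, hdist T _ (huopt T).1, ?_⟩
  have h := le_of_affine_recursion (e := fun k => ∫ ω, ‖w k ω - uopt k‖ ∂P) hρ0 hρ1 hσ0 hrec
  simpa [fun ω => (hloop ω).w_zero] using h
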